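/- **Setting.** Let $g:\mathbb R^n\to\mathbb R^m$ be differentiable with locally Lipschitz derivative, with $\Gamma:=\{x: g(x)\le 0\}\neq\emptyset$; let $f:\mathbb R^n\to(-\infty,\infty]$ be proper and lower semicontinuous, and finite and differentiable with locally Lipschitz gradient on an open convex set $\mathcal O\supset\Gamma$; let $\phi,\psi:\mathbb R^n\to\mathbb R$ be convex; and let $F:=f+\phi-\psi+\delta_{\mathbb R^m_-}(g(\cdot))$ be bounded below on $\Gamma$. Here $\delta_C$ is the indicator function of $C$ ($0$ on $C$, $+\infty$ elsewhere), $\partial$ is the limiting (Mordukhovich) subdifferential, $\mathcal N_C=\partial\delta_C$ is the normal cone, $\psi^*$ is the conjugate of $\psi$, $\|\cdot\|$ is the Euclidean norm, $t_+=\max\{t,0\}$ (componentwise for vectors), and $\nabla g(x)$ is the transposed Jacobian. Put $$G(x,s,L)=g(s)+g'(s)(x-s)+\tfrac12\|x-s\|^2L .$$ **Inexact moving balls approximation method.** Parameters: $0<\mu_{\min}\le\mu_{\max}$, $0<L_{\min}\le L_{\max}$, $M,\beta_R,\beta_F,\alpha>0$, $\tau>1$; start: $x^0\in\Gamma$. For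 $k=0,1,2,\dots$ choose $\xi^k\in\partial(-\psi)(x^k)$, $\mu_{k,0}\in[\mu_{\min},\mu_{\max}]$ and $L^{k,0}\in[L_{\min},L_{\max}]^m$. For $j=0,1,2,\dots$ choose a self-adjoint linear map $\mathcal Q_{k,j}$ with $\mu_{k,j}\mathcal I\preceq\mathcal Q_{k,j}\preceq(\mu_{k,j}+M)\mathcal I$, and set $$\vartheta_{k,j}(x)=f(x^k)-\psi(x^k)+\langle\nabla f(x^k)+\xi^k,x-x^k\rangle+\tfrac12\langle x-x^k,\mathcal Q_{k,j}(x-x^k)\rangle,\qquad F_{k,j}=\vartheta_{k,j}+\phi .$$ Let $\overline x^{k,j}$ be the minimizer of $F_{k,j}$ over $\{x: G(x,x^k,L^{k,j})\le0\}$, and find $y^{k,j}\in\mathbb R^n$, $v^{k,j}\in\partial\phi(y^{k,j})$ and $\lambda^{k,j}\in\mathbb R^m_+$ such that $$R_{k,j}(y^{k,j},v^{k,j},\lambda^{k,j})\le\tfrac{\beta_R}2\|y^{k,j}-x^k\|^2,\quad F_{k,j}(y^{k,j})\le F_{k,j}(x^k),\quad F_{k,j}(y^{k,j})-F_{k,j}(\overline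 x^{k,j})\le\tfrac{\beta_F}2\|y^{k,j}-x^k\|^2,$$ where, with $w:=\nabla\vartheta_{k,j}(x)+v+\nabla_xG(x,x^k,L^{k,j})\lambda$, $$R_{k,j}(x,v,\lambda)=\langle x,w\rangle_++\big(-\langle\lambda,G(x,x^k,L^{k,j})\rangle\big)_++\|w\|+\|[G(x,x^k,L^{k,j})]_+\|_\infty .$$ If $g(y^{k,j})\le0$ and $F(y^{k,j})\le F(x^k)-\frac\alpha2\|y^{k,j}-x^k\|^2$, end the inner loop with $j_k:=j$. Otherwise, if $g(y^{k,j})\not\le0$, put $L^{k,j+1}=\tau L^{k,j}$, $\mu_{k,j+1}=\mu_{k,j}$; else put $L^{k,j+1}=L^{k,j}$, $\mu_{k,j+1}=\tau\mu_{k,j}$. After the inner loop set $x^{k+1}=y^{k,j_k}$, $\overline x^k=\overline x^{k,j_k}$, $L^k=L^{k,j_k}$, $\mathcal Q_k=\mathcal Q_{k,j_k}$. **Theorem.** Consider an infinite run of this method, and suppose that: 1. for all $k$ and all $j\le j_k$, the multifunction $x\mapsto G(x,x^k,L^{k,j})-\mathbb R^m_-$ is metrically subregular at $(\overline x^{k,j},0)$;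 2. $\{x^k\}$ is bounded; 3. with $u^k=(L^k,\mathcal Q_k,\xi^k,x^k)$ and $\mathbb U=\mathbb R^m_+\times\{\text{positive definite self-adjoint linear maps}\}\times\mathbb R^n\times\mathbb R^n$, the partial bounded multiplier property with respect to $x$ holds at every cluster point $(u^*,\overline x^*)$ of $\{(u^k,\overline x^k)\}$. That is, writing $H(u,x)=G(x,s,L)$ for $u=(L,\mathcal Q,\xi,s)$ and $\mathcal S(u)=\{x:H(u,x)\le0\}$, one has $u^*\in\mathbb U$, $\overline x^*\in\mathcal S(u^*)$, and there are $\kappa>0$ and neighbourhoods $\mathcal U$ of $u^*$ in $\mathbb U$ and $\mathcal V$ of $\overline x^*$ such that for all $u\in\mathcal U$, $x\in\mathcal V\cap\mathcal S(u)$ and $y\in\mathcal N_{\mathcal S(u)}(x)$ there is $\lambda\in\mathcal N_{\mathbb R^m_-}(H(u,x))$ with $\nabla_xH(u,x)\lambda=y$ and $\|\lambda\|\le\kappa\|y\|$; 4. $g$ is twice differentiable, and $\psi^*$ is continuous relative to its domain; 5. for some $q\in[1/2,1)$, the function $$\Phi(x,s,L,\xi)=f(x)+\phi(x)+\delta_{\mathbb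 R^m_-}(G(x,s,L))+\langle x,\xi\rangle+\psi^*(-\xi)$$ on $\mathbb R^n\times\mathbb R^n\times\mathbb R^m_{++}\times\mathbb R^n$ has the Kurdyka–Łojasiewicz property of exponent $q$ at every cluster point $\overline z$ of $z^k=(\overline x^k,x^k,L^k,\xi^k)$. That is, $\partial\Phi(\overline z)\ne\emptyset$, and there are $\delta,c>0$ and $\eta\in(0,\infty]$ such that $c(1-q)(\Phi(z)-\Phi(\overline z))^{-q}\,\mathrm{dist}(0,\partial\Phi(z))\ge1$ whenever $\|z-\overline z\|\le\delta$ and $\Phi(\overline z)<\Phi(z)<\Phi(\overline z)+\eta$ (with $\mathrm{dist}(0,\emptyset)=\infty$). Then there are $\varpi^*\in\mathbb R$ and $x^*\in\mathbb R^n$ with $F(x^k)\to\varpi^*$ and $x^k\to x^*$, and: (i) if $q=1/2$, there exist $\widehat a_1>0$ and $\rho,\widehat\rho\in(0,1)$ such that for all $k$ large enough $$F(x^{k+1})-\varpi^*\le\rho\,(F(x^k)-\varpi^*)\quad\text{and}\quad\|x^k-x^*\|\le\widehat a_1\widehat\rho^{\,k};$$ (ii) if $q\in(1/2,1)$, there exist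 $\widehat a_2,\widehat a_3>0$ such that for all $k$ large enough $$F(x^k)-\varpi^*\le\widehat a_2k^{\frac1{1-2q}}\quad\text{and}\quad\|x^k-x^*\|\le\widehat a_3k^{\frac{1-q}{1-2q}}.$$ -/

import Mathlib

open Filter Topology
open scoped InnerProductSpace

noncomputable section

/-- `ℝⁿ` with the Euclidean norm. -/
abbrev Vec (n : ℕ) : Type := EuclideanSpace ℝ (Fin n)

/-! ### Variational analysis -/

section Variational

variable {V : Type*} [NormedAddCommGroup V] [InnerProductSpace ℝ V]

/-- Regular (Fréchet) subdifferential of an extended-real-valued function at a point where it is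
finite. The condition `liminf (h x' - h x - ⟪v, x' - x⟫) / ‖x' - x‖ ≥ 0` as `x' → x`, `x' ≠ x`, is
written out with `ε`. -/
def regSubdiff (h : V → EReal) (x : V) : Set V :=
  {v | h x ≠ ⊤ ∧ h x ≠ ⊥ ∧ ∀ ε : ℝ, 0 < ε → ∀ᶠ x' in 𝓝 x,
    h x + ((⟪v, x' - x⟫_ℝ - ε * ‖x' - x‖ : ℝ) : EReal) ≤ h x'}

/-- Basic (limiting, Mordukhovich) subdifferential at a point where `h` is finite. -/
def limSubdiff (h : V → EReal) (x : V) : Set V :=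
  {v | h x ≠ ⊤ ∧ h x ≠ ⊥ ∧ ∃ (a : ℕ → V) (b : ℕ → V),
    Tendsto a atTop (𝓝 x) ∧ Tendsto (fun k => h (a k)) atTop (𝓝 (h x)) ∧
    (∀ k, b k ∈ regSubdiff h (a k)) ∧ Tendsto b atTop (𝓝 v)}

open Classical in
/-- The indicator function `δ_C`: `0` on `C` and `+∞` off `C`. -/
def indicatorFn {X : Type*} (C : Set X) (x : X) : EReal := if x ∈ C then 0 else ⊤

/-- The (limiting) normal cone to `C` at `x`: the subdifferential of the indicator function. It is
empty when `x ∉ C`. -/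
def normalCone (C : Set V) (x : V) : Set V := limSubdiff (indicatorFn C) x

/-- The conjugate function `h*` of a finite function `h`. -/
def conjugateFn (h : V → ℝ) (y : V) : EReal := ⨆ x : V, ((⟪y, x⟫_ℝ - h x : ℝ) : EReal)

/-- The KL property of exponent `q` of `h` at `x₀ ∈ dom ∂h`: the desingularizing function is
`t ↦ c t ^ (1 - q)`, whose derivative is `t ↦ c (1 - q) t ^ (-q)`. The distance of `0` to an empty
subdifferential is `∞`. -/
def HasKLExponentAt (h : V → EReal) (q : ℝ) (x₀ : V) : Prop :=
  (limSubdiff h x₀).Nonempty ∧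
  ∃ δ : ℝ, 0 < δ ∧ ∃ η : EReal, 0 < η ∧ ∃ c : ℝ, 0 < c ∧
    ∀ x ∈ Metric.closedBall x₀ δ, h x₀ < h x → h x < h x₀ + η →
      1 ≤ ENNReal.ofReal (c * (1 - q) * (h x - h x₀).toReal ^ (-q)) *
        Metric.infEDist 0 (limSubdiff h x)

/-- Metric subregularity of the multifunction `S` at `(x₀, y₀) ∈ gph S`. -/
def IsSubregularAt {X Y : Type*} [PseudoEMetricSpace Y] [PseudoMetricSpace X]
    (S : X → Set Y) (x₀ : X) (y₀ : Y) : Prop :=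
  y₀ ∈ S x₀ ∧ ∃ δ : ℝ, 0 < δ ∧ ∃ κ : ℝ, 0 < κ ∧ ∀ x ∈ Metric.closedBall x₀ δ,
    Metric.infEDist x {x' | y₀ ∈ S x'} ≤ ENNReal.ofReal κ * Metric.infEDist y₀ (S x)

end Variational

/-- The non-positive orthant `ℝᵐ₋`. -/
def nonposOrthant (m : ℕ) : Set (Vec m) := {w | ∀ i, w i ≤ 0}

/-- The multifunction `x ↦ H x - ℝᵐ₋`. -/
def constraintMultifunction {n m : ℕ} (H : Vec n → Vec m) (x : Vec n) : Set (Vec m) :=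
  {z | ∃ w ∈ nonposOrthant m, z = H x - w}

/-- The partial bounded multiplier property with respect to `x`, at `(u₀, x₀)`, of the parametric
system `H u x ∈ ℝᵐ₋`, the parameter `u` ranging over the set `U`. Here `∇ₓH(u,x)` is the adjoint of
the derivative of `H u` at `x`. -/
def PartialBMP {n m : ℕ} {P : Type*} [TopologicalSpace P] (U : Set P) (H : P → Vec n → Vec m)
    (u₀ : P) (x₀ : Vec n) : Prop :=
  u₀ ∈ U ∧ H u₀ x₀ ∈ nonposOrthant m ∧
  ∃ κ : ℝ, 0 < κ ∧ ∃ 𝒰 ∈ 𝓝 u₀, ∃ 𝒱 ∈ 𝓝 x₀,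
    ∀ u ∈ 𝒰 ∩ U, ∀ x ∈ 𝒱, H u x ∈ nonposOrthant m →
      ∀ y ∈ normalCone {x' | H u x' ∈ nonposOrthant m} x,
        ∃ lam ∈ normalCone (nonposOrthant m) (H u x),
          ContinuousLinearMap.adjoint (fderiv ℝ (H u) x) lam = y ∧ ‖lam‖ ≤ κ * ‖y‖

/-! ### The constrained DC problem -/

/-- The data of the problem `min f(x) + φ(x) - ψ(x)` subject to `g(x) ≤ 0`. -/
structure DCProblem (n m : ℕ) where
  f : Vec n → EReal
  phi : Vec n → ℝ
  psi : Vec n → ℝ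
  g : Vec n → Vec m

namespace DCProblem

variable {n m : ℕ} (P : DCProblem n m)

/-- The feasible set `Γ = g⁻¹(ℝᵐ₋)`. -/
def feasible : Set (Vec n) := {x | P.g x ∈ nonposOrthant m}

/-- The objective `F = f + φ - ψ + δ_{ℝᵐ₋} ∘ g`. -/
def F (x : Vec n) : EReal :=
  P.f x + ((P.phi x - P.psi x : ℝ) : EReal) + indicatorFn (nonposOrthant m) (P.g x)

/-- `∇f(x)`, used only at points near which `f` is finite and differentiable. -/
def gradf (x : Vec n) : Vec n := gradient (fun x' => (P.f x').toReal) x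

/-- The basic conditions on the data. -/
structure Admissible : Prop where
  g_differentiable : Differentiable ℝ P.g
  g_locallyLipschitz : LocallyLipschitz (fderiv ℝ P.g)
  feasible_nonempty : P.feasible.Nonempty
  f_ne_bot : ∀ x, P.f x ≠ ⊥
  f_proper : ∃ x, P.f x ≠ ⊤
  f_lsc : LowerSemicontinuous P.f
  f_smooth : ∃ O : Set (Vec n), IsOpen O ∧ Convex ℝ O ∧ P.feasible ⊆ O ∧ (∀ x ∈ O, P.f x ≠ ⊤) ∧
    DifferentiableOn ℝ (fun x => (P.f x).toReal) O ∧ LocallyLipschitzOn O P.gradf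
  phi_convex : ConvexOn ℝ Set.univ P.phi
  psi_convex : ConvexOn ℝ Set.univ P.psi
  bounded_below : ∃ b : ℝ, ∀ x ∈ P.feasible, (b : EReal) ≤ P.F x

/-- `∂φ(x)`. -/
def subdiffPhi (x : Vec n) : Set (Vec n) := limSubdiff (fun x' => ((P.phi x' : ℝ) : EReal)) x

/-- `∂(-ψ)(x)`. -/
def subdiffNegPsi (x : Vec n) : Set (Vec n) := limSubdiff (fun x' => ((-P.psi x' : ℝ) : EReal)) x

/-- `G(x,s,L) = g(s) + g'(s)(x - s) + ½ ‖x - s‖² L`. -/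
def G (x s : Vec n) (L : Vec m) : Vec m :=
  P.g s + fderiv ℝ P.g s (x - s) + ((1 / 2 : ℝ) * ‖x - s‖ ^ 2) • L

/-- The local model `ϑ` of `f - ψ` at `s`, with metric `Q` and `ξ ∈ ∂(-ψ)(s)`. -/
def vartheta (s xi : Vec n) (Q : Vec n →L[ℝ] Vec n) (x : Vec n) : ℝ :=
  ⟪P.gradf s + xi, x - s⟫_ℝ + (1 / 2 : ℝ) * ⟪x - s, Q (x - s)⟫_ℝ + (P.f s).toReal - P.psi s

/-- The objective of the subproblem, `ϑ + φ`. -/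
def subObjective (s xi : Vec n) (Q : Vec n →L[ℝ] Vec n) (x : Vec n) : ℝ :=
  P.vartheta s xi Q x + P.phi x

/-- The feasible set of the subproblem, `{x | G(x,s,L) ≤ 0}`. -/
def subFeasible (s : Vec n) (L : Vec m) : Set (Vec n) := {x | P.G x s L ∈ nonposOrthant m}

/-- `∇ϑ(x) + v + ∇ₓG(x,s,L) λ`. -/
def lagrangeGrad (s xi : Vec n) (Q : Vec n →L[ℝ] Vec n) (L : Vec m)
    (x v : Vec n) (lam : Vec m) : Vec n :=
  gradient (P.vartheta s xi Q) x + v +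
    ContinuousLinearMap.adjoint (fderiv ℝ (fun x' => P.G x' s L) x) lam

/-- The KKT residual of the subproblem; the last summand is the `ℓ_∞` norm of `[G(x,s,L)]₊`. -/
def residual (s xi : Vec n) (Q : Vec n →L[ℝ] Vec n) (L : Vec m)
    (x v : Vec n) (lam : Vec m) : ℝ :=
  max ⟪x, P.lagrangeGrad s xi Q L x v lam⟫_ℝ 0 + max (-⟪lam, P.G x s L⟫_ℝ) 0
    + ‖P.lagrangeGrad s xi Q L x v lam‖ + ‖(fun i => max (P.G x s L i) 0 : Fin m → ℝ)‖

end DCProblem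

/-! ### The inexact moving balls approximation method -/

/-- The input parameters of the method. -/
structure MBAParams where
  (muMin muMax LMin LMax M betaR betaF alpha tau : ℝ)
  muMin_pos : 0 < muMin
  muMin_le : muMin ≤ muMax
  LMin_pos : 0 < LMin
  LMin_le : LMin ≤ LMax
  M_pos : 0 < M
  betaR_pos : 0 < betaR
  betaF_pos : 0 < betaF
  alpha_pos : 0 < alpha
  tau_gt_one : 1 < tau

/-- Everything produced by the method: the outer iterates `x k`, the vectors `xi k`, the index
`jEnd k` at which the `k`-th inner loop ends, and the quantities of the inner loop. The latter are
meaningful for `j ≤ jEnd k` only; `xbar k j` is the exact solution of the `(k,j)`-th subproblem,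
`y k j` the inexact one and `(v k j, lam k j)` the accompanying multipliers. -/
structure MBATrace (n m : ℕ) where
  x : ℕ → Vec n
  xi : ℕ → Vec n
  jEnd : ℕ → ℕ
  mu : ℕ → ℕ → ℝ
  L : ℕ → ℕ → Vec m
  Q : ℕ → ℕ → (Vec n →L[ℝ] Vec n)
  xbar : ℕ → ℕ → Vec n
  y : ℕ → ℕ → Vec n
  v : ℕ → ℕ → Vec n
  lam : ℕ → ℕ → Vec m

namespace MBATrace

variable {n m : ℕ} (T : MBATrace n m) (P : DCProblem n m) (p : MBAParams)

/-- The test that ends the inner loop. -/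
def Accepts (k j : ℕ) : Prop :=
  P.g (T.y k j) ∈ nonposOrthant m ∧
  P.F (T.y k j) ≤ P.F (T.x k) - ((p.alpha / 2 * ‖T.y k j - T.x k‖ ^ 2 : ℝ) : EReal)

/-- `T` is an (infinite) run of the inexact moving balls approximation method with parameters `p`
on the problem `P`. -/
structure IsRun : Prop where
  init : T.x 0 ∈ P.feasible
  xi_mem : ∀ k, T.xi k ∈ P.subdiffNegPsi (T.x k)
  mu_init : ∀ k, T.mu k 0 ∈ Set.Icc p.muMin p.muMax
  L_init : ∀ k i, T.L k 0 i ∈ Set.Icc p.LMin p.LMax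
  /-- `μ I ⪯ Q` -/
  Q_lower : ∀ k, ∀ j ≤ T.jEnd k,
    (T.Q k j - T.mu k j • ContinuousLinearMap.id ℝ (Vec n)).IsPositive
  /-- `Q ⪯ (μ + M) I` -/
  Q_upper : ∀ k, ∀ j ≤ T.jEnd k,
    ((T.mu k j + p.M) • ContinuousLinearMap.id ℝ (Vec n) - T.Q k j).IsPositive
  xbar_mem : ∀ k, ∀ j ≤ T.jEnd k, T.xbar k j ∈ P.subFeasible (T.x k) (T.L k j)
  xbar_min : ∀ k, ∀ j ≤ T.jEnd k,
    IsMinOn (P.subObjective (T.x k) (T.xi k) (T.Q k j)) (P.subFeasible (T.x k) (T.L k j))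
      (T.xbar k j)
  v_mem : ∀ k, ∀ j ≤ T.jEnd k, T.v k j ∈ P.subdiffPhi (T.y k j)
  lam_nonneg : ∀ k, ∀ j ≤ T.jEnd k, ∀ i, 0 ≤ T.lam k j i
  inexact_residual : ∀ k, ∀ j ≤ T.jEnd k,
    P.residual (T.x k) (T.xi k) (T.Q k j) (T.L k j) (T.y k j) (T.v k j) (T.lam k j)
      ≤ p.betaR / 2 * ‖T.y k j - T.x k‖ ^ 2
  inexact_descent : ∀ k, ∀ j ≤ T.jEnd k,
    P.subObjective (T.x k) (T.xi k) (T.Q k j) (T.y k j)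
      ≤ P.subObjective (T.x k) (T.xi k) (T.Q k j) (T.x k)
  inexact_value : ∀ k, ∀ j ≤ T.jEnd k,
    P.subObjective (T.x k) (T.xi k) (T.Q k j) (T.y k j)
        - P.subObjective (T.x k) (T.xi k) (T.Q k j) (T.xbar k j)
      ≤ p.betaF / 2 * ‖T.y k j - T.x k‖ ^ 2
  not_accepts : ∀ k, ∀ j < T.jEnd k, ¬ T.Accepts P p k j
  increase_L : ∀ k, ∀ j < T.jEnd k, P.g (T.y k j) ∉ nonposOrthant m →
    T.L k (j + 1) = p.tau • T.L k j ∧ T.mu k (j + 1) = T.mu k j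
  increase_mu : ∀ k, ∀ j < T.jEnd k, P.g (T.y k j) ∈ nonposOrthant m →
    T.L k (j + 1) = T.L k j ∧ T.mu k (j + 1) = p.tau * T.mu k j
  accepts : ∀ k, T.Accepts P p k (T.jEnd k)
  step : ∀ k, T.x (k + 1) = T.y k (T.jEnd k)

/-- Subregularity of the constraint systems of all subproblems at their exact solutions. -/
def SubproblemsSubregular : Prop :=
  ∀ k, ∀ j ≤ T.jEnd k,
    IsSubregularAt (constraintMultifunction fun x => P.G x (T.x k) (T.L k j)) (T.xbar k j) 0

/-- The parameters `u = (L, Q, ξ, s)` of the subproblems. -/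
abbrev Param (n m : ℕ) : Type := Vec m × (Vec n →L[ℝ] Vec n) × Vec n × Vec n

/-- `𝕌 = ℝᵐ₊ × 𝕊 × ℝⁿ × ℝⁿ`, with `𝕊` the positive definite linear mappings. -/
def paramSet (n m : ℕ) : Set (Param n m) :=
  {u | (∀ i, 0 ≤ u.1 i) ∧ u.2.1.IsPositive ∧ ∀ x : Vec n, x ≠ 0 → 0 < ⟪x, u.2.1 x⟫_ℝ}

/-- `uᵏ = (Lᵏ, Q_k, ξᵏ, xᵏ)`, the quantities at the end of the `k`-th inner loop. -/
def u (k : ℕ) : Param n m := (T.L k (T.jEnd k), T.Q k (T.jEnd k), T.xi k, T.x k)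

/-- The partial bounded multiplier property of the system `G(x,s,L) ≤ 0`, with `u = (L,Q,ξ,s)`
as parameter, at all cluster points of the sequence `(uᵏ, x̄ᵏ)`. -/
def BMPAtClusterPoints : Prop :=
  ∀ w : Param n m × Vec n,
    MapClusterPt w atTop (fun k => (T.u k, T.xbar k (T.jEnd k))) →
    PartialBMP (paramSet n m) (fun u x => P.G x u.2.2.2 u.1) w.1 w.2

end MBATrace

/-! ### The potential function -/

/-- Quadruples `z = (x, s, L, ξ)` with the Euclidean norm of `ℝⁿ × ℝⁿ × ℝᵐ × ℝⁿ`. -/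
abbrev ZSpace (n m : ℕ) : Type :=
  WithLp 2 (Vec n × WithLp 2 (Vec n × WithLp 2 (Vec m × Vec n)))

namespace ZSpace

variable {n m : ℕ}

def mk (x s : Vec n) (L : Vec m) (xi : Vec n) : ZSpace n m :=
  WithLp.toLp 2 (x, WithLp.toLp 2 (s, WithLp.toLp 2 (L, xi)))

def x (z : ZSpace n m) : Vec n := z.fst
def s (z : ZSpace n m) : Vec n := z.snd.fst
def L (z : ZSpace n m) : Vec m := z.snd.snd.fst
def xi (z : ZSpace n m) : Vec n := z.snd.snd.snd

end ZSpace

open Classical in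
/-- The potential function `Φ(x,s,L,ξ) = f(x) + φ(x) + δ(G(x,s,L) ≤ 0) + ⟪x, ξ⟫ + ψ*(-ξ)` on the
open set `L > 0`; it is given the value `+∞` off this set. -/
def DCProblem.potential {n m : ℕ} (P : DCProblem n m) (z : ZSpace n m) : EReal :=
  if ∀ i, 0 < z.L i then
    P.f z.x + ((P.phi z.x : ℝ) : EReal) + indicatorFn (nonposOrthant m) (P.G z.x z.s z.L)
      + ((⟪z.x, z.xi⟫_ℝ : ℝ) : EReal) + conjugateFn P.psi (-z.xi)
  else ⊤

/-- `zᵏ = (x̄ᵏ, xᵏ, Lᵏ, ξᵏ)`. -/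
def MBATrace.z {n m : ℕ} (T : MBATrace n m) (k : ℕ) : ZSpace n m :=
  ZSpace.mk (T.xbar k (T.jEnd k)) (T.x k) (T.L k (T.jEnd k)) (T.xi k)

end

/-! Write r_k = F(x^k) − ϖ and D_k = ‖x^{k+1} − x^k‖. Everything follows from two inequalities: the
sufficient decrease (α/2) D_k² ≤ r_k − r_{k+1}, which is the acceptance test, and the error bound
r_{k+1}^q ≤ c D_k for large k. `convergence_rates_of_kl` uses nothing else: concavity of t ↦ t^(1−q)
makes the steps summable, and squaring the error bound gives r_{k+1}^(2q) ≤ const · (r_k − r_{k+1}),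
a recursion that decays linearly for q = 1/2 and like a power of k for q > 1/2.

The error bound comes from the KL inequality for Φ at z^k, whose first component is the exact
solution x̄^k. The bounded multiplier property and compactness give KKT multipliers bounded in k;
quadratic growth of the Lagrangian and the O(D_k²) inexactness tolerances then give ‖x̄^k − x^k‖ =
O(D_k) (`IsRun.exists_kkt_bounds`). Hence F(x^{k+1}) − O(D_k²) ≤ Φ(z^k) ≤ F(x^k) + O(D_k²) and
dist(0, ∂Φ(z^k)) = O(D_k) (`IsRun.exists_potential_bounds`).

The subgradient estimate avoids subdifferential calculus. Replacing φ and ψ* by supporting affine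
functions and the indicator by ⟨λ, G⟩ produces a minorant of Φ near z^k, differentiable at z^k and
touching Φ there, so its gradient is a regular subgradient of Φ. Stationarity cancels every term of
that gradient without a factor x̄^k − x^k.

Finally Φ equals ϖ at all cluster points of z^k, so the local KL inequalities merge into one by
compactness, and the O(D_k²) discrepancy between F and Φ is absorbed because D_k^(2q) ≤ D_k once D_k
≤ 1 and q ≥ 1/2. -/

/-! ### Convex subgradients, normal cones and smooth minorants. -/

section Subdifferentials

variable {V : Type*} [NormedAddCommGroup V] [InnerProductSpace ℝ V]

/-- Fermat's rule for a finite convex function plus a linear one over a convex set. -/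
theorem ConvexOn.exists_subgradient_of_forall_nonneg [CompleteSpace V] {h : V → ℝ} {S : Set V}
    (hh : ConvexOn ℝ Set.univ h) (hc : Continuous h) (hS : Convex ℝ S) {x₀ a : V} (hx₀ : x₀ ∈ S)
    (hmin : ∀ x ∈ S, 0 ≤ ⟪a, x - x₀⟫_ℝ + h x - h x₀) :
    ∃ v : V, (∀ y, h x₀ + ⟪v, y - x₀⟫_ℝ ≤ h y) ∧ ∀ x ∈ S, 0 ≤ ⟪a + v, x - x₀⟫_ℝ := by
  let H : V → ℝ := fun x => ⟪a, x - x₀⟫_ℝ + h x - h x₀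
  have hHc : Continuous H := by fun_prop
  let A : Set (V × ℝ) := {r | H r.1 < r.2}
  have hAo : IsOpen A := isOpen_lt (hHc.comp continuous_fst) continuous_snd
  have hAc : Convex ℝ A := by
    intro r hr s hs b c hb hc' hbc
    simp only [A, Set.mem_ofPred_eq] at hr hs ⊢
    have h1 := hh.2 (Set.mem_univ r.1) (Set.mem_univ s.1) hb hc' hbc
    simp only [smul_eq_mul] at h1
    have h2 : H (b • r + c • s).1 ≤ b * H r.1 + c * H s.1 := by
      simp only [H, Prod.fst_add, Prod.smul_fst, inner_sub_right, inner_add_right,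
        real_inner_smul_right]
      obtain rfl : c = 1 - b := by linarith
      linarith
    refine h2.trans_lt ?_
    simp only [Prod.snd_add, Prod.smul_snd, smul_eq_mul]
    rcases hb.eq_or_lt with rfl | hb
    · obtain rfl : c = 1 := by linarith
      simpa using hs
    · have := mul_lt_mul_of_pos_left hr hb
      have := mul_le_mul_of_nonneg_left hs.le hc'
      linarith
  have hBc : Convex ℝ (S ×ˢ Set.Iic (0 : ℝ)) := hS.prod (convex_Iic 0)
  have hdisj : Disjoint A (S ×ˢ Set.Iic (0 : ℝ)) := by
    rw [Set.disjoint_left]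
    rintro ⟨x, t⟩ hr ⟨hx, ht⟩
    have := hmin x hx
    simp only [A, H, Set.mem_ofPred_eq, Set.mem_Iic] at hr ht
    linarith
  -- The open strict epigraph of H is separated from S × (−∞, 0]. The functional has negative weight
  -- on the second coordinate; dividing by minus that weight turns its V-part into a subgradient p
  -- of H at x₀ which is minimal over S at x₀, and p − a is the required subgradient of h.
  obtain ⟨f, u, hfA, hfB⟩ := geometric_hahn_banach_open hAc hAo hBc hdisj
  have hf : ∀ x t, f (x, t) = f (x, 0) + t * f (0, 1) := by
    intro x t
    have : ((x, t) : V × ℝ) = (x, 0) + t • (0, 1) := by simp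
    rw [this, map_add, map_smul, smul_eq_mul]
  have hβ : f (0, 1) < 0 := by
    have h1 := hfA (x₀, 1) (by simp [A, H])
    have h2 := hfB (x₀, 0) ⟨hx₀, by simp⟩
    rw [hf] at h1
    linarith
  have hA' : ∀ x, f (x, 0) + H x * f (0, 1) ≤ u := by
    intro x
    by_contra hcon
    push Not at hcon
    have hd : 0 < f (x, 0) + H x * f (0, 1) - u := by linarith
    have := hfA (x, H x + (f (x, 0) + H x * f (0, 1) - u) / (-f (0, 1)))
      (by simp only [A, Set.mem_ofPred_eq]
          have : 0 < (f (x, 0) + H x * f (0, 1) - u) / (-f (0, 1)) := div_pos hd (by linarith)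
          linarith)
    rw [hf, add_mul, div_neg, neg_mul, div_mul_cancel₀ _ hβ.ne] at this
    linarith
  have hu1 : f (x₀, 0) ≤ u := by
    have := hA' x₀
    simpa [H] using this
  have hu2 : ∀ x ∈ S, u ≤ f (x, 0) := fun x hx => hfB (x, 0) ⟨hx, by simp⟩
  let ℓ : V →L[ℝ] ℝ := (-(f (0, 1))⁻¹) • (f.comp (ContinuousLinearMap.inl ℝ V ℝ))
  let p : V := (InnerProductSpace.toDual ℝ V).symm ℓ
  have hp : ∀ x, ⟪p, x⟫_ℝ = -(f (0, 1))⁻¹ * f (x, 0) := by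
    intro x
    rw [InnerProductSpace.toDual_symm_apply]
    simp [ℓ]
  have hβ' : 0 < -(f (0, 1))⁻¹ := by
    have := inv_lt_zero.2 hβ
    linarith
  have hx₀S := hu2 x₀ hx₀
  refine ⟨p - a, fun y => ?_, fun x hx => ?_⟩
  · have h1 : f (y, 0) + H y * f (0, 1) ≤ f (x₀, 0) := (hA' y).trans hx₀S
    have h2 := mul_le_mul_of_nonneg_left h1 hβ'.le
    have h3 : -(f (0, 1))⁻¹ * (f (y, 0) + H y * f (0, 1)) = ⟪p, y⟫_ℝ - H y := by
      rw [hp]; field_simp [hβ.ne]; ring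
    rw [h3, ← hp] at h2
    simp only [H] at h2
    rw [inner_sub_left, inner_sub_right p]
    linarith
  · have h1 := mul_le_mul_of_nonneg_left (hu1.trans (hu2 x hx)) hβ'.le
    rw [← hp, ← hp] at h1
    rw [add_sub_cancel, inner_sub_right]
    linarith

theorem mem_normalCone_of_forall_inner_nonpos {C : Set V} {x v : V} (hx : x ∈ C)
    (h : ∀ y ∈ C, ⟪v, y - x⟫_ℝ ≤ 0) : v ∈ normalCone C x := by
  have hx0 : indicatorFn C x = 0 := if_pos hx
  refine ⟨by simp [hx0], by simp [hx0], fun _ => x, fun _ => v, tendsto_const_nhds,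
    tendsto_const_nhds, fun _ => ⟨by simp [hx0], by simp [hx0], fun ε hε => ?_⟩,
    tendsto_const_nhds⟩
  refine Eventually.of_forall fun y => ?_
  by_cases hy : y ∈ C
  · rw [hx0, zero_add, indicatorFn, if_pos hy]
    have := h y hy
    have h2 : 0 ≤ ε * ‖y - x‖ := by positivity
    exact_mod_cast (by linarith : ⟪v, y - x⟫_ℝ - ε * ‖y - x‖ ≤ 0)
  · rw [indicatorFn.eq_1 C y, if_neg hy]
    exact le_top

/-- A regular normal at a k is tested on the points a k + t (y − a k) with small t > 0, which stay
in C by convexity; dividing by t and letting ε → 0 gives the inequality at a k, and it passes to the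
limit. -/
theorem Convex.inner_nonpos_of_mem_normalCone {C : Set V} (hC : Convex ℝ C) {x v : V}
    (hv : v ∈ normalCone C x) : ∀ y ∈ C, ⟪v, y - x⟫_ℝ ≤ 0 := by
  obtain ⟨-, -, a, b, ha, -, hb, hbv⟩ := hv
  intro y hy
  have key : ∀ k, ⟪b k, y - a k⟫_ℝ ≤ 0 := by
    intro k
    obtain ⟨h1, -, h3⟩ := hb k
    have hak : a k ∈ C := by
      by_contra hcon
      exact h1 (if_neg hcon)
    have hak0 : indicatorFn C (a k) = 0 := if_pos hak
    refine le_of_forall_pos_le_add fun e he => ?_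
    obtain ⟨ε, hε, hεe⟩ : ∃ ε > 0, ε * ‖y - a k‖ ≤ e := by
      refine ⟨e / (‖y - a k‖ + 1), by positivity, ?_⟩
      rw [div_mul_eq_mul_div, div_le_iff₀ (by positivity)]
      nlinarith [norm_nonneg (y - a k)]
    have h4 : Tendsto (fun t : ℝ => a k + t • (y - a k)) (𝓝[>] 0) (𝓝 (a k)) := by
      refine tendsto_nhdsWithin_of_tendsto_nhds ?_
      have : Continuous fun t : ℝ => a k + t • (y - a k) := by fun_prop
      simpa using this.tendsto 0
    obtain ⟨t, ht1, ht2⟩ := ((h4.eventually (h3 ε hε)).and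
      (Ioc_mem_nhdsGT (zero_lt_one' ℝ))).exists
    have hmem : a k + t • (y - a k) ∈ C := hC.add_smul_sub_mem hak hy ⟨ht2.1.le, ht2.2⟩
    rw [hak0, zero_add, indicatorFn, if_pos hmem, add_sub_cancel_left, real_inner_smul_right,
      norm_smul, Real.norm_of_nonneg ht2.1.le] at ht1
    have ht1' : t * ⟪b k, y - a k⟫_ℝ - ε * (t * ‖y - a k‖) ≤ 0 := by exact_mod_cast ht1
    have h5 : t * (⟪b k, y - a k⟫_ℝ - ε * ‖y - a k‖) ≤ 0 := by linarith
    have h6 : ⟪b k, y - a k⟫_ℝ - ε * ‖y - a k‖ ≤ 0 := nonpos_of_mul_nonpos_right h5 ht2.1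
    linarith
  exact le_of_tendsto (hbv.inner (tendsto_const_nhds.sub ha)) (Eventually.of_forall key)

/-- The limiting subgradients of a concave function are supergradients. -/
theorem ConvexOn.le_of_mem_limSubdiff_neg {ψ : V → ℝ} (hψ : ConvexOn ℝ Set.univ ψ)
    (hc : Continuous ψ) {x ξ : V} (hξ : ξ ∈ limSubdiff (fun x => ((-ψ x : ℝ) : EReal)) x) (y : V) :
    ψ x - ⟪ξ, y - x⟫_ℝ ≤ ψ y := by
  obtain ⟨-, -, a, b, ha, -, hb, hbv⟩ := hξ
  have key : ∀ k, ψ (a k) - ⟪b k, y - a k⟫_ℝ ≤ ψ y := by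
    intro k
    obtain ⟨-, -, h3⟩ := hb k
    refine le_of_forall_pos_le_add fun e he => ?_
    obtain ⟨ε, hε, hεe⟩ : ∃ ε > 0, ε * ‖y - a k‖ ≤ e := by
      refine ⟨e / (‖y - a k‖ + 1), by positivity, ?_⟩
      rw [div_mul_eq_mul_div, div_le_iff₀ (by positivity)]
      nlinarith [norm_nonneg (y - a k)]
    -- The test point lies beyond a k, on the side away from y. The regular subgradient inequality
    -- for −ψ bounds ψ there from above, and a k is the convex combination of that point and y with
    -- weights 1/(1+t) and t/(1+t).
    have h4 : Tendsto (fun t : ℝ => a k + (-t) • (y - a k)) (𝓝[>] 0) (𝓝 (a k)) := by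
      refine tendsto_nhdsWithin_of_tendsto_nhds ?_
      have : Continuous fun t : ℝ => a k + (-t) • (y - a k) := by fun_prop
      simpa using this.tendsto 0
    obtain ⟨t, ht1, ht2⟩ := ((h4.eventually (h3 ε hε)).and self_mem_nhdsWithin).exists
    have ht : 0 < t := ht2
    rw [add_sub_cancel_left, real_inner_smul_right, norm_smul, Real.norm_eq_abs, abs_neg,
      abs_of_pos ht] at ht1
    have ht1' : -ψ (a k) + (-t * ⟪b k, y - a k⟫_ℝ - ε * (t * ‖y - a k‖))
        ≤ -ψ (a k + (-t) • (y - a k)) := by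
      beta_reduce at ht1
      exact_mod_cast ht1
    have h5 := hψ.2 (Set.mem_univ (a k + (-t) • (y - a k))) (Set.mem_univ y)
      (by positivity : 0 ≤ 1 / (1 + t)) (by positivity : 0 ≤ t / (1 + t)) (by field_simp)
    have h6 : (1 / (1 + t)) • (a k + (-t) • (y - a k)) + (t / (1 + t)) • y = a k := by
      match_scalars <;> field_simp <;> ring
    rw [h6, smul_eq_mul, smul_eq_mul] at h5
    have h7 : (1 + t) * ψ (a k) ≤ ψ (a k + (-t) • (y - a k)) + t * ψ y := by
      have := mul_le_mul_of_nonneg_left h5 (by positivity : 0 ≤ 1 + t)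
      refine this.trans_eq ?_
      field_simp
    have h8 : t * (ψ (a k) - ⟪b k, y - a k⟫_ℝ) ≤ t * (ψ y + ε * ‖y - a k‖) := by linarith
    have h9 := le_of_mul_le_mul_left h8 ht
    linarith
  exact le_of_tendsto (((hc.tendsto x).comp ha).sub (hbv.inner (tendsto_const_nhds.sub ha)))
    (Eventually.of_forall key)

theorem le_conjugateFn (ψ : V → ℝ) (y x : V) : ((⟪y, x⟫_ℝ - ψ x : ℝ) : EReal) ≤ conjugateFn ψ y :=
  le_iSup (fun x : V => ((⟪y, x⟫_ℝ - ψ x : ℝ) : EReal)) x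

/-- Equality in the Fenchel–Young inequality. -/
theorem conjugateFn_eq_of_subgradient {ψ : V → ℝ} {x y : V}
    (h : ∀ x', ψ x + ⟪y, x' - x⟫_ℝ ≤ ψ x') :
    conjugateFn ψ y = ((⟪y, x⟫_ℝ - ψ x : ℝ) : EReal) := by
  refine le_antisymm (iSup_le fun x' => ?_) (le_conjugateFn ψ y x)
  have := h x'
  rw [inner_sub_right] at this
  exact_mod_cast (by linarith : ⟪y, x'⟫_ℝ - ψ x' ≤ ⟪y, x⟫_ℝ - ψ x)

/-- The norm of the derivative of a local minorant that touches `h` at `x` bounds the distance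
from `0` to the subdifferential. -/
theorem infEDist_limSubdiff_le_of_minorant [CompleteSpace V] {h : V → EReal} {f : V → ℝ} {x : V}
    {f' : V →L[ℝ] ℝ} (hx : h x = f x) (hle : ∀ᶠ x' in 𝓝 x, (f x' : EReal) ≤ h x')
    (hf : HasFDerivAt f f' x) :
    Metric.infEDist 0 (limSubdiff h x) ≤ ENNReal.ofReal ‖f'‖ := by
  let w := (InnerProductSpace.toDual ℝ V).symm f'
  have hw : w ∈ regSubdiff h x := by
    refine ⟨by simp [hx], by simp [hx], fun ε hε => ?_⟩
    filter_upwards [hle, hf.isLittleO.def hε] with x' h1 h2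
    refine le_trans ?_ h1
    rw [hx, ← EReal.coe_add, EReal.coe_le_coe_iff, InnerProductSpace.toDual_symm_apply]
    have := (abs_le.1 h2).1
    linarith
  have hw' : w ∈ limSubdiff h x := ⟨hw.1, hw.2.1, fun _ => x, fun _ => w, tendsto_const_nhds,
    tendsto_const_nhds, fun _ => hw, tendsto_const_nhds⟩
  refine (Metric.infEDist_le_edist_of_mem hw').trans ?_
  rw [edist_dist, dist_zero_left]
  simp [w]

/-- Polarization: with y the multiple of Q x of norm ‖x‖, 4⟪Q x, y⟫ is the difference of the
quadratic form at x + y and at x − y, hence at most c ‖x + y‖² ≤ 4 c ‖x‖². -/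
theorem norm_apply_le_of_isPositive {Q : V →L[ℝ] V} {c : ℝ}
    (h0 : ∀ x, 0 ≤ ⟪x, Q x⟫_ℝ) (hsymm : ∀ x y, ⟪Q x, y⟫_ℝ = ⟪x, Q y⟫_ℝ)
    (hc : ∀ x, ⟪x, Q x⟫_ℝ ≤ c * ‖x‖ ^ 2) (x : V) : ‖Q x‖ ≤ c * ‖x‖ := by
  have hc0 : 0 ≤ c * ‖x‖ ^ 2 := (h0 x).trans (hc x)
  by_cases hQ : Q x = 0
  · rcases (norm_nonneg x).eq_or_lt with h | h
    · simp [hQ, ← h]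
    · rw [hQ, norm_zero]
      have : 0 ≤ c := nonneg_of_mul_nonneg_left hc0 (by positivity)
      positivity
  have hQn : 0 < ‖Q x‖ := norm_pos_iff.2 hQ
  have hx : 0 < ‖x‖ := norm_pos_iff.2 (by rintro rfl; simp at hQ)
  have hcpos : 0 ≤ c := nonneg_of_mul_nonneg_left hc0 (by positivity)
  set y := (‖x‖ / ‖Q x‖) • Q x with hy
  have hyn : ‖y‖ = ‖x‖ := by
    rw [hy, norm_smul, Real.norm_of_nonneg (by positivity)]; field_simp
  have hxy : ⟪Q x, y⟫_ℝ = ‖x‖ * ‖Q x‖ := by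
    rw [hy, real_inner_smul_right, real_inner_self_eq_norm_sq]; field_simp
  have h1 := h0 (x - y)
  have h2 := hc (x + y)
  have e1 : ⟪x - y, Q (x - y)⟫_ℝ = ⟪x + y, Q (x + y)⟫_ℝ - 4 * ⟪Q x, y⟫_ℝ := by
    have e2 : ⟪y, Q x⟫_ℝ = ⟪Q x, y⟫_ℝ := real_inner_comm _ _
    have e3 := hsymm x y
    simp only [map_sub, map_add, inner_sub_left, inner_sub_right, inner_add_left, inner_add_right]
    linarith
  have h3 : ‖x + y‖ ≤ 2 * ‖x‖ := (norm_add_le _ _).trans (by rw [hyn]; linarith)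
  have h4 : c * ‖x + y‖ ^ 2 ≤ c * (2 * ‖x‖) ^ 2 := by gcongr
  have h5 : ‖x‖ * ‖Q x‖ ≤ ‖x‖ * (c * ‖x‖) := by rw [← hxy]; linarith
  exact le_of_mul_le_mul_left h5 hx

/-- The subgradient inequality is tested at distance r from x in the direction of v itself. -/
theorem norm_le_of_subgradient {h : V → ℝ} {x v : V} {K r : ℝ} (hr : 0 < r)
    (hK : ∀ y, dist y x ≤ r → h y - h x ≤ K * dist y x) (hv : ∀ y, h x + ⟪v, y - x⟫_ℝ ≤ h y) :
    ‖v‖ ≤ max K 0 := by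
  by_cases hv0 : v = 0
  · simp [hv0]
  have hvn : 0 < ‖v‖ := norm_pos_iff.2 hv0
  have hd : dist (x + (r / ‖v‖) • v) x = r := by
    rw [dist_eq_norm, add_sub_cancel_left, norm_smul, Real.norm_of_nonneg (by positivity)]
    field_simp
  have h1 := hK (x + (r / ‖v‖) • v) hd.le
  have h2 := hv (x + (r / ‖v‖) • v)
  rw [add_sub_cancel_left, real_inner_smul_right, real_inner_self_eq_norm_sq] at h2
  rw [hd] at h1
  have h3 : r / ‖v‖ * ‖v‖ ^ 2 = ‖v‖ * r := by field_simp
  have h4 : ‖v‖ * r ≤ K * r := by linarith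
  exact (le_of_mul_le_mul_right h4 hr).trans (le_max_left _ _)

end Subdifferentials

/-- A property with a constant that holds eventually near each cluster point of a bounded sequence
holds eventually. -/
theorem exists_eventually_of_mapClusterPt {X : Type*} [PseudoMetricSpace X] [ProperSpace X]
    {a : ℕ → X} (ha : Bornology.IsBounded (Set.range a)) {p : ℝ → ℕ → Prop}
    (hp : ∀ c c' k, c ≤ c' → p c k → p c' k)
    (h : ∀ x, MapClusterPt x atTop a → ∃ c, ∃ U ∈ 𝓝 x, ∀ᶠ k in atTop, a k ∈ U → p c k) :
    ∃ c, ∀ᶠ k in atTop, p c k := by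
  have hcomp : IsCompact (closure (Set.range a)) := ha.isCompact_closure
  have : ∃ c, ∀ᶠ k in atTop, a k ∈ closure (Set.range a) → p c k := by
    -- Constants merge by maximum over a finite cover; a point that is not a cluster point has a
    -- neighbourhood which the sequence eventually avoids, so any constant serves there.
    refine hcomp.induction_on (p := fun s => ∃ c, ∀ᶠ k in atTop, a k ∈ s → p c k)
      ⟨0, by simp⟩ ?_ ?_ ?_
    · rintro s t hst ⟨c, hc⟩
      exact ⟨c, hc.mono fun k hk hs => hk (hst hs)⟩
    · rintro s t ⟨c, hc⟩ ⟨c', hc'⟩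
      refine ⟨max c c', ?_⟩
      filter_upwards [hc, hc'] with k h1 h2 h3
      exact h3.elim (fun h => hp _ _ _ (le_max_left _ _) (h1 h))
        (fun h => hp _ _ _ (le_max_right _ _) (h2 h))
    · intro x _
      by_cases hx : MapClusterPt x atTop a
      · obtain ⟨c, U, hU, hc⟩ := h x hx
        exact ⟨U, mem_nhdsWithin_of_mem_nhds hU, c, hc⟩
      · rw [mapClusterPt_iff_frequently] at hx
        push Not at hx
        obtain ⟨U, hU, hUk⟩ := hx
        exact ⟨U, mem_nhdsWithin_of_mem_nhds hU, 0, hUk.mono fun k h1 h2 => absurd h2 h1⟩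
  obtain ⟨c, hc⟩ := this
  exact ⟨c, hc.mono fun k hk => hk (subset_closure ⟨k, rfl⟩)⟩

/-! ### Rates for abstract sequences with sufficient decrease and an error bound. -/

section Rates

/-- Tangent inequality for the concave function t ↦ t^(1−q) at u, obtained from Bernoulli's
inequality for v/u. It converts a decrease of r into a telescoping decrease of r^(1−q). -/
theorem sub_le_rpow_mul_rpow_sub_rpow {q u v : ℝ} (hq0 : 0 ≤ q) (hq1 : q < 1) (hv : 0 ≤ v)
    (hvu : v ≤ u) : (1 - q) * (u - v) ≤ u ^ q * (u ^ (1 - q) - v ^ (1 - q)) := by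
  rcases (hv.trans hvu).eq_or_lt with h | hu
  · obtain rfl : v = 0 := le_antisymm (by rwa [h]) hv
    simp [← h]
  have h1 := rpow_one_add_le_one_add_mul_self (s := v / u - 1) (p := 1 - q)
    (by have : 0 ≤ v / u := by positivity
        linarith) (by linarith) (by linarith)
  rw [add_sub_cancel, Real.div_rpow hv hu.le, div_le_iff₀ (by positivity)] at h1
  have h2 : u ^ q * u ^ (1 - q) = u := by
    rw [← Real.rpow_add hu, add_sub_cancel, Real.rpow_one]
  have h3 := mul_le_mul_of_nonneg_left h1 (by positivity : 0 ≤ u ^ q)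
  have h4 : u ^ q * ((1 + (1 - q) * (v / u - 1)) * u ^ (1 - q)) = u + (1 - q) * (v - u) := by
    calc _ = (1 + (1 - q) * (v / u - 1)) * (u ^ q * u ^ (1 - q)) := by ring
      _ = _ := by rw [h2]; field_simp
  rw [h4] at h3
  rw [mul_sub (u ^ q), h2]
  linarith

/-- Bernoulli's inequality for k/(k+1) = 1 − 1/(k+1). The factor 2^s pays for replacing k^(−s) by
(k+1)^(−s), since k + 1 ≤ 2k. -/
theorem rpow_neg_sub_rpow_neg_le {s : ℝ} (hs : 1 ≤ s) {k : ℕ} (hk : 1 ≤ k) :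
    (k : ℝ) ^ (-s) - ((k + 1 : ℕ) : ℝ) ^ (-s) ≤ s * 2 ^ s * ((k + 1 : ℕ) : ℝ) ^ (-s - 1) := by
  have hk' : (1 : ℝ) ≤ k := by exact_mod_cast hk
  have hk0 : (0 : ℝ) < k := by linarith
  have hk1 : (0 : ℝ) < (k : ℝ) + 1 := by linarith
  push_cast
  have h1 := one_add_mul_self_le_rpow_one_add (s := -(1 / ((k : ℝ) + 1)))
    (by rw [neg_le_neg_iff, div_le_one hk1]; linarith) hs
  have h2 : 1 + -(1 / ((k : ℝ) + 1)) = k / (k + 1) := by field_simp; ring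
  rw [h2, Real.div_rpow hk0.le hk1.le] at h1
  have h3 := mul_le_mul_of_nonneg_left h1 (by positivity : 0 ≤ (k : ℝ) ^ (-s))
  have h4 : (k : ℝ) ^ (-s) * ((k : ℝ) ^ s / ((k : ℝ) + 1) ^ s) = ((k : ℝ) + 1) ^ (-s) := by
    rw [Real.rpow_neg hk0.le, Real.rpow_neg hk1.le]
    have := (Real.rpow_pos_of_pos hk0 s).ne'
    field_simp
  rw [h4] at h3
  have h5 : (k : ℝ) ^ (-s) ≤ 2 ^ s * ((k : ℝ) + 1) ^ (-s) := by
    have : (k : ℝ) ^ (-s) ≤ (((k : ℝ) + 1) / 2) ^ (-s) :=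
      Real.rpow_le_rpow_of_nonpos (by positivity) (by linarith) (by linarith)
    refine this.trans_eq ?_
    rw [Real.div_rpow hk1.le (by norm_num), Real.rpow_neg (by norm_num : (0 : ℝ) ≤ 2)]
    field_simp
  have h6 : ((k : ℝ) + 1) ^ (-s - 1) = ((k : ℝ) + 1) ^ (-s) / ((k : ℝ) + 1) :=
    Real.rpow_sub_one hk1.ne' _
  rw [h6]
  have h7 : (k : ℝ) ^ (-s) * (s / ((k : ℝ) + 1))
      ≤ 2 ^ s * ((k : ℝ) + 1) ^ (-s) * (s / ((k : ℝ) + 1)) := by gcongr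
  calc _ ≤ (k : ℝ) ^ (-s) * (s / ((k : ℝ) + 1)) := by
        have : (k : ℝ) ^ (-s) * (1 + s * -(1 / ((k : ℝ) + 1)))
            = (k : ℝ) ^ (-s) - (k : ℝ) ^ (-s) * (s / ((k : ℝ) + 1)) := by ring
        linarith
    _ ≤ _ := h7
    _ = _ := by ring

/-- Sublinear decay from `r (k+1) ^ (1+p) ≤ B (r k - r (k+1))`. -/
theorem eventually_le_mul_rpow_of_rpow_le_sub {r : ℕ → ℝ} {p B : ℝ}
    (hp : 0 < p) (hp1 : p ≤ 1) (hB : 0 < B)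
    (h : ∀ᶠ k in atTop, r (k + 1) ^ (1 + p) ≤ B * (r k - r (k + 1))) :
    ∃ A, 0 < A ∧ ∀ᶠ k : ℕ in atTop, r k ≤ A * (k : ℝ) ^ (-(1 / p)) := by
  obtain ⟨K, hK⟩ := eventually_atTop.1 (h.and (eventually_ge_atTop 1))
  have hK1 : 1 ≤ K := (hK K le_rfl).2
  have hK0 : (0 : ℝ) < K := by exact_mod_cast hK1
  set s := 1 / p with hs
  have hs1 : 1 ≤ s := by rw [hs, le_div_iff₀ hp]; linarith
  -- The first entry starts the induction at K. The second gives A^p ≥ B s 2^s: if the bound held at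
  -- k and failed at k + 1, the drop of r would be smaller than that of A k^(−s), too small for the
  -- recursion. Here (1 + p) s = s + 1.
  set A := max (r K * (K : ℝ) ^ s) ((B * (s * 2 ^ s)) ^ s) with hA
  have hApos : 0 < A := lt_of_lt_of_le (by positivity) (le_max_right _ _)
  refine ⟨A, hApos, eventually_atTop.2 ⟨K, fun k hk => ?_⟩⟩
  induction k, hk using Nat.le_induction with
  | base =>
    rw [Real.rpow_neg hK0.le, ← div_eq_mul_inv, le_div_iff₀ (by positivity)]
    exact le_max_left _ _
  | succ k hk ih =>
    by_contra hcon
    push Not at hcon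
    have hk1 : 1 ≤ k := hK1.trans hk
    have h1 := (hK k hk).1
    have hpos : (0 : ℝ) < ((k + 1 : ℕ) : ℝ) := by positivity
    set y := ((k + 1 : ℕ) : ℝ) with hy
    have h2 : (A * y ^ (-s)) ^ (1 + p) < r (k + 1) ^ (1 + p) :=
      Real.rpow_lt_rpow (by positivity) hcon (by linarith)
    have h3 : (A * y ^ (-s)) ^ (1 + p) = A * A ^ p * y ^ (-s - 1) := by
      rw [Real.mul_rpow hApos.le (by positivity), ← Real.rpow_mul hpos.le, Real.rpow_add hApos,
        Real.rpow_one]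
      congr 2
      rw [hs]; field_simp
      ring
    have h4 := rpow_neg_sub_rpow_neg_le hs1 hk1
    rw [← hy] at h4
    have h5 : r k - r (k + 1) ≤ A * (s * 2 ^ s * y ^ (-s - 1)) := by
      have := mul_le_mul_of_nonneg_left h4 hApos.le
      linarith
    have h6 : A * A ^ p * y ^ (-s - 1) < B * (A * (s * 2 ^ s * y ^ (-s - 1))) := by
      rw [← h3]
      exact h2.trans_le (h1.trans (by gcongr))
    have h7 : A ^ p * (A * y ^ (-s - 1)) < B * (s * 2 ^ s) * (A * y ^ (-s - 1)) := by linarith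
    have h8 := lt_of_mul_lt_mul_right h7 (by positivity)
    have h9 : B * (s * 2 ^ s) ≤ A ^ p := by
      have h10 : ((B * (s * 2 ^ s)) ^ s) ^ p ≤ A ^ p :=
        Real.rpow_le_rpow (by positivity) (le_max_right _ _) hp.le
      rwa [← Real.rpow_mul (by positivity), hs, one_div_mul_cancel hp.ne', Real.rpow_one] at h10
    linarith

theorem eventually_le_mul_pow_of_le_mul {r : ℕ → ℝ} {ρ : ℝ} (hr : ∀ k, 0 ≤ r k) (hρ : 0 < ρ)
    (h : ∀ᶠ k in atTop, r (k + 1) ≤ ρ * r k) :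
    ∃ A, 0 ≤ A ∧ ∀ᶠ k : ℕ in atTop, r k ≤ A * ρ ^ k := by
  obtain ⟨K, hK⟩ := eventually_atTop.1 h
  refine ⟨r K / ρ ^ K, div_nonneg (hr K) (by positivity), eventually_atTop.2 ⟨K, fun k hk => ?_⟩⟩
  induction k, hk using Nat.le_induction with
  | base => field_simp; rfl
  | succ k hk ih =>
    calc r (k + 1) ≤ ρ * r k := hK k hk
      _ ≤ ρ * (r K / ρ ^ K * ρ ^ k) := by gcongr
      _ = _ := by ring

variable {E : Type*} [NormedAddCommGroup E] [CompleteSpace E]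

/-- Finite length of sequences with sufficient decrease and a Kurdyka–Łojasiewicz inequality. -/
theorem exists_tendsto_of_kl {x : ℕ → E} {r : ℕ → ℝ} {q a C : ℝ} (hq : q ∈ Set.Ico (1 / 2 : ℝ) 1)
    (hr : ∀ k, 0 ≤ r k) (hr0 : Tendsto r atTop (𝓝 0)) (ha : 0 < a) (hC : 0 < C)
    (hdec : ∀ k, a * ‖x (k + 1) - x k‖ ^ 2 ≤ r k - r (k + 1))
    (hkl : ∀ᶠ k in atTop, r (k + 1) ^ q ≤ C * ‖x (k + 1) - x k‖) :
    ∃ xs : E, Tendsto x atTop (𝓝 xs) ∧ ∃ A, 0 < A ∧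
      ∀ᶠ k in atTop, ‖x (k + 1) - xs‖ ≤ A * r k ^ (1 - q) := by
  obtain ⟨hq0, hq1⟩ := hq
  have hq1' : 0 < 1 - q := by linarith
  set D : ℕ → ℝ := fun k => ‖x (k + 1) - x k‖ with hD
  have hD0 : ∀ k, 0 ≤ D k := fun k => norm_nonneg _
  set B : ℝ := C / (a * (1 - q)) with hB
  have hBpos : 0 < B := by positivity
  have hmono : ∀ k, r (k + 1) ≤ r k := fun k => by
    have := hdec k
    have : 0 ≤ a * ‖x (k + 1) - x k‖ ^ 2 := by positivity
    linarith
  have hDr : ∀ k, D k ≤ Real.sqrt (1 / a) * r k ^ (1 / 2 : ℝ) := by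
    intro k
    rw [← Real.sqrt_eq_rpow, ← Real.sqrt_mul (by positivity)]
    refine Real.le_sqrt_of_sq_le ?_
    have h1 := hdec k
    have h2 := hr (k + 1)
    rw [one_div, inv_mul_eq_div, le_div_iff₀ ha]
    change ‖x (k + 1) - x k‖ ^ 2 * a ≤ r k
    linarith
  -- A Lyapunov quantity whose decrease dominates the next step length. The error bound and the
  -- concavity estimate give D(k+1)² ≤ D(k) · B S, with S the decrease of r^(1−q); the
  -- arithmetic-geometric mean inequality then yields 2 D(k+1) ≤ D(k) + B S.
  set W : ℕ → ℝ := fun k => D k + B * r (k + 1) ^ (1 - q) with hW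
  have hW0 : ∀ k, 0 ≤ W k := fun k => by
    have := hD0 k
    have := Real.rpow_nonneg (hr (k + 1)) (1 - q)
    positivity
  have hstep : ∀ᶠ k in atTop, D (k + 1) ≤ W k - W (k + 1) := by
    filter_upwards [hkl] with k hk
    have h1 := hdec (k + 1)
    have h2 := sub_le_rpow_mul_rpow_sub_rpow (by linarith : 0 ≤ q) hq1 (hr (k + 2)) (hmono (k + 1))
    set S := r (k + 1) ^ (1 - q) - r (k + 2) ^ (1 - q) with hS
    have hS0 : 0 ≤ S :=
      sub_nonneg.2 (Real.rpow_le_rpow (hr _) (hmono (k + 1)) hq1'.le)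
    have h3 : D (k + 1) ^ 2 ≤ D k * (B * S) := by
      have h4 : r (k + 1) ^ q * S ≤ C * D k * S := by gcongr
      have h5 : a * (1 - q) * D (k + 1) ^ 2 ≤ C * D k * S := by
        have := mul_le_mul_of_nonneg_left h1 hq1'.le
        change (1 - q) * (a * D (k + 1) ^ 2) ≤ _ at this
        linarith
      have h6 : D k * (B * S) = C * D k * S / (a * (1 - q)) := by rw [hB]; field_simp
      rw [h6, le_div_iff₀ (by positivity)]
      linarith
    have h7 : D (k + 1) ≤ (D k + B * S) / 2 := by
      refine abs_le_of_sq_le_sq' ?_ (by have := hD0 k; positivity) |>.2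
      nlinarith [sq_nonneg (D k - B * S)]
    simp only [hW]
    change D (k + 1) ≤ D k + B * r (k + 1) ^ (1 - q) - (D (k + 1) + B * r (k + 2) ^ (1 - q))
    rw [hS] at h7
    linarith
  obtain ⟨K, hK⟩ := eventually_atTop.1 hstep
  have hdist : ∀ k, K ≤ k → ∀ N, dist (x (k + 1)) (x (k + 1 + N)) ≤ W k - W (k + N) := by
    intro k hk N
    induction N with
    | zero => simp
    | succ N ih =>
      have h1 := hK (k + N) (by omega)
      have h2 : dist (x (k + 1 + N)) (x (k + 1 + (N + 1))) = D (k + N + 1) := by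
        rw [dist_comm, dist_eq_norm, hD]
        simp only [show k + 1 + (N + 1) = k + N + 1 + 1 by omega,
          show k + 1 + N = k + N + 1 by omega]
      have h3 := dist_triangle (x (k + 1)) (x (k + 1 + N)) (x (k + 1 + (N + 1)))
      rw [← add_assoc k N 1]
      linarith
  have hWle : ∀ᶠ k in atTop, W k ≤ (Real.sqrt (1 / a) + B) * r k ^ (1 - q) := by
    filter_upwards [hr0.eventually (gt_mem_nhds zero_lt_one)] with k hk
    have h1 : r (k + 1) ^ (1 - q) ≤ r k ^ (1 - q) := Real.rpow_le_rpow (hr _) (hmono k) hq1'.le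
    -- The exponent 1/2 is at least 1 − q and r k < 1, so the square-root term coming from the
    -- decrease is the smaller one.
    have h2 : r k ^ (1 / 2 : ℝ) ≤ r k ^ (1 - q) := by
      rcases (hr k).eq_or_lt with h | h
      · rw [← h, Real.zero_rpow (by norm_num), Real.zero_rpow hq1'.ne']
      · exact Real.rpow_le_rpow_of_exponent_ge h hk.le (by linarith)
    have h3 : Real.sqrt (1 / a) * r k ^ (1 / 2 : ℝ) ≤ Real.sqrt (1 / a) * r k ^ (1 - q) := by
      gcongr
    have h4 : B * r (k + 1) ^ (1 - q) ≤ B * r k ^ (1 - q) := by gcongr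
    have h5 := hDr k
    simp only [hW]
    linarith
  have hW0' : Tendsto W atTop (𝓝 0) := by
    refine squeeze_zero' (Eventually.of_forall hW0) hWle ?_
    have := (hr0.rpow_const (p := 1 - q) (Or.inr hq1'.le)).const_mul (Real.sqrt (1 / a) + B)
    rwa [Real.zero_rpow hq1'.ne', mul_zero] at this
  have hdist' : ∀ k, K ≤ k → ∀ N, dist (x (k + 1)) (x (k + 1 + N)) ≤ W k := fun k hk N =>
    (hdist k hk N).trans (by linarith [hW0 (k + N)])
  have hcauchy : CauchySeq x := by
    rw [Metric.cauchySeq_iff']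
    intro ε hε
    obtain ⟨k, hk1, hk2⟩ := ((hW0'.eventually (gt_mem_nhds hε)).and (eventually_ge_atTop K)).exists
    refine ⟨k + 1, fun n hn => ?_⟩
    obtain ⟨N, rfl⟩ := Nat.exists_eq_add_of_le hn
    rw [dist_comm]
    exact (hdist' k hk2 N).trans_lt hk1
  obtain ⟨xs, hxs⟩ := cauchySeq_tendsto_of_complete hcauchy
  refine ⟨xs, hxs, Real.sqrt (1 / a) + B, by positivity, ?_⟩
  filter_upwards [hWle, eventually_ge_atTop K] with k hk hkK
  refine le_trans ?_ hk
  rw [← dist_eq_norm]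
  have h1 : Tendsto (fun N => x (k + 1 + N)) atTop (𝓝 xs) := by
    have := (tendsto_add_atTop_iff_nat (k + 1)).2 hxs
    simpa only [add_comm _ (k + 1)] using this
  exact le_of_tendsto (tendsto_const_nhds.dist h1) (Eventually.of_forall (hdist' k hkK))

/-- Convergence rates of sequences with sufficient decrease and a Kurdyka–Łojasiewicz inequality of
exponent `q`. -/
theorem convergence_rates_of_kl {x : ℕ → E} {r : ℕ → ℝ} {q a C : ℝ}
    (hq : q ∈ Set.Ico (1 / 2 : ℝ) 1)
    (hr : ∀ k, 0 ≤ r k) (hr0 : Tendsto r atTop (𝓝 0)) (ha : 0 < a) (hC : 0 < C)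
    (hdec : ∀ k, a * ‖x (k + 1) - x k‖ ^ 2 ≤ r k - r (k + 1))
    (hkl : ∀ᶠ k in atTop, r (k + 1) ^ q ≤ C * ‖x (k + 1) - x k‖) :
    ∃ xs : E, Tendsto x atTop (𝓝 xs) ∧
      (q = 1 / 2 →
        ∃ a₁ : ℝ, 0 < a₁ ∧ ∃ ρ ∈ Set.Ioo (0 : ℝ) 1, ∃ ρ' ∈ Set.Ioo (0 : ℝ) 1,
          ∀ᶠ k : ℕ in atTop, r (k + 1) ≤ ρ * r k ∧ ‖x k - xs‖ ≤ a₁ * ρ' ^ k) ∧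
      (1 / 2 < q →
        ∃ a₂ : ℝ, 0 < a₂ ∧ ∃ a₃ : ℝ, 0 < a₃ ∧
          ∀ᶠ k : ℕ in atTop, r k ≤ a₂ * (k : ℝ) ^ (1 / (1 - 2 * q)) ∧
            ‖x k - xs‖ ≤ a₃ * (k : ℝ) ^ ((1 - q) / (1 - 2 * q))) := by
  obtain ⟨xs, hxs, A, hA, hAle⟩ := exists_tendsto_of_kl hq hr hr0 ha hC hdec hkl
  obtain ⟨hq0, hq1⟩ := hq
  have hq1' : 0 < 1 - q := by linarith
  have hdiff : ∀ᶠ k in atTop, r (k + 1) ^ (2 * q) ≤ C ^ 2 / a * (r k - r (k + 1)) := by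
    filter_upwards [hkl] with k hk
    have h1 : (r (k + 1) ^ q) ^ 2 ≤ (C * ‖x (k + 1) - x k‖) ^ 2 :=
      pow_le_pow_left₀ (Real.rpow_nonneg (hr _) _) hk 2
    have h2 : r (k + 1) ^ (2 * q) = (r (k + 1) ^ q) ^ 2 := by
      rw [mul_comm, Real.rpow_mul (hr _)]; norm_cast
    rw [h2]
    refine h1.trans ?_
    have h3 : C ^ 2 / a * (a * ‖x (k + 1) - x k‖ ^ 2) ≤ C ^ 2 / a * (r k - r (k + 1)) := by
      gcongr
      exact hdec k
    refine le_trans (le_of_eq ?_) h3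
    field_simp
  refine ⟨xs, hxs, fun hq => ?_, fun hq => ?_⟩
  · set B := C ^ 2 / a with hB
    have hBpos : 0 < B := by positivity
    set ρ := B / (1 + B) with hρ
    have hρ0 : 0 < ρ := by positivity
    have hρ1 : ρ < 1 := by rw [hρ, div_lt_one (by positivity)]; linarith
    have hlin : ∀ᶠ k in atTop, r (k + 1) ≤ ρ * r k := by
      filter_upwards [hdiff] with k hk
      rw [hq, show (2 : ℝ) * (1 / 2) = 1 by norm_num, Real.rpow_one] at hk
      rw [hρ, div_mul_eq_mul_div, le_div_iff₀ (by positivity)]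
      linarith
    obtain ⟨A', hA', hA'le⟩ := eventually_le_mul_pow_of_le_mul hr hρ0 hlin
    have hσ0 : 0 < Real.sqrt ρ := Real.sqrt_pos.2 hρ0
    -- Division by √ρ accounts for the estimate being about x (k+1) rather than x k; the summand 1
    -- keeps the constant positive when A' = 0.
    refine ⟨A * Real.sqrt A' / Real.sqrt ρ + 1, by positivity, ρ, ⟨hρ0, hρ1⟩, Real.sqrt ρ,
      ⟨hσ0, by rw [Real.sqrt_lt' one_pos]; simpa using hρ1⟩, ?_⟩
    have hx : ∀ᶠ k in atTop, ‖x (k + 1) - xs‖ ≤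
        (A * Real.sqrt A' / Real.sqrt ρ + 1) * Real.sqrt ρ ^ (k + 1) := by
      filter_upwards [hAle, hA'le] with k h1 h2
      rw [hq, show (1 : ℝ) - 1 / 2 = 1 / 2 by norm_num, ← Real.sqrt_eq_rpow] at h1
      have h3 : Real.sqrt (r k) ≤ Real.sqrt A' * Real.sqrt ρ ^ k := by
        refine Real.sqrt_le_iff.2 ⟨by positivity, ?_⟩
        rw [mul_pow, Real.sq_sqrt hA', ← pow_mul, mul_comm k 2, pow_mul, Real.sq_sqrt hρ0.le]
        exact h2
      calc ‖x (k + 1) - xs‖ ≤ A * (Real.sqrt A' * Real.sqrt ρ ^ k) := h1.trans (by gcongr)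
        _ = A * Real.sqrt A' / Real.sqrt ρ * Real.sqrt ρ ^ (k + 1) := by
          rw [pow_succ]; field_simp
        _ ≤ _ := by gcongr; linarith
    have hx' : ∀ᶠ k in atTop, ‖x k - xs‖ ≤
        (A * Real.sqrt A' / Real.sqrt ρ + 1) * Real.sqrt ρ ^ k := by
      rw [← map_add_atTop_eq_nat 1]
      exact hx
    filter_upwards [hlin, hx'] with k h1 h2 using ⟨h1, h2⟩
  · set p := 2 * q - 1 with hp
    have hp0 : 0 < p := by linarith
    obtain ⟨A', hA', hA'le⟩ := eventually_le_mul_rpow_of_rpow_le_sub hp0 (by linarith)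
      (by positivity : 0 < C ^ 2 / a)
      (hdiff.mono fun k hk => by rwa [show 1 + p = 2 * q by rw [hp]; ring])
    have he1 : 1 / (1 - 2 * q) = -(1 / p) := by
      rw [show 1 - 2 * q = -p by rw [hp]; ring, div_neg]
    set e := (1 - q) / (1 - 2 * q) with he
    have hee : e = -(1 / p) * (1 - q) := by rw [← he1, he]; ring
    have he0 : e ≤ 0 := by
      rw [hee]
      have : 0 ≤ 1 / p * (1 - q) := by positivity
      linarith
    -- The factor (1/2)^e, with e ≤ 0, absorbs the shift from k to k + 1 through k ≥ (k+1)/2.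
    refine ⟨A', hA', A * A' ^ (1 - q) * (1 / 2 : ℝ) ^ e, by positivity, ?_⟩
    have hx : ∀ᶠ k in atTop, ‖x (k + 1) - xs‖ ≤
        A * A' ^ (1 - q) * (1 / 2 : ℝ) ^ e * ((k + 1 : ℕ) : ℝ) ^ e := by
      filter_upwards [hAle, hA'le, eventually_ge_atTop 1] with k h1 h2 hk
      have hk' : (1 : ℝ) ≤ k := by exact_mod_cast hk
      have h3 : r k ^ (1 - q) ≤ A' ^ (1 - q) * (k : ℝ) ^ e := by
        rw [hee, Real.rpow_mul (by positivity), ← Real.mul_rpow hA'.le (by positivity)]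
        exact Real.rpow_le_rpow (hr k) h2 hq1'.le
      have h4 : (k : ℝ) ^ e ≤ (1 / 2 : ℝ) ^ e * ((k + 1 : ℕ) : ℝ) ^ e := by
        rw [← Real.mul_rpow (by norm_num) (by positivity)]
        refine Real.rpow_le_rpow_of_nonpos (by positivity) ?_ he0
        push_cast
        linarith
      calc ‖x (k + 1) - xs‖ ≤ A * (A' ^ (1 - q) * ((1 / 2 : ℝ) ^ e * ((k + 1 : ℕ) : ℝ) ^ e)) :=
            h1.trans (by gcongr; exact h3.trans (by gcongr))
        _ = _ := by ring
    rw [he1]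
    have hx' : ∀ᶠ k : ℕ in atTop, ‖x k - xs‖ ≤
        A * A' ^ (1 - q) * (1 / 2 : ℝ) ^ e * (k : ℝ) ^ e := by
      rw [← map_add_atTop_eq_nat 1]
      exact hx
    filter_upwards [hA'le, hx'] with k h1 h2 using ⟨h1, h2⟩

end Rates

/-! ### Taylor and subgradient bounds, uniform on bounded sets. -/

section Smoothness

variable {E E' : Type*} [NormedAddCommGroup E] [NormedSpace ℝ E] [NormedAddCommGroup E']
  [NormedSpace ℝ E']

/-- A first-order Taylor estimate on a segment. -/
theorem norm_sub_sub_le_of_hasFDerivAt_segment {h : E → E'} {h' : E → E →L[ℝ] E'} {C : ℝ} {x y : E}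
    (hC : 0 ≤ C) (hh : ∀ z ∈ segment ℝ x y, HasFDerivAt h (h' z) z)
    (hL : ∀ z ∈ segment ℝ x y, ‖h' z - h' x‖ ≤ C * ‖z - x‖) :
    ‖h y - h x - h' x (y - x)‖ ≤ C * ‖y - x‖ ^ 2 := by
  have h1 : ∀ z ∈ segment ℝ x y, ‖h' z - h' x‖ ≤ C * ‖y - x‖ := by
    intro z hz
    refine (hL z hz).trans ?_
    gcongr
    exact norm_sub_le_of_mem_segment hz
  have := (convex_segment x y).norm_image_sub_le_of_norm_hasFDerivWithin_le'
    (fun z hz => (hh z hz).hasFDerivWithinAt) h1 (left_mem_segment ℝ x y) (right_mem_segment ℝ x y)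
  rwa [mul_assoc, ← sq] at this

end Smoothness

namespace DCProblem

variable {n m : ℕ} {P : DCProblem n m}

/-- The real value `f + φ - ψ`. -/
noncomputable def realObjective (P : DCProblem n m) (x : Vec n) : ℝ :=
  (P.f x).toReal + (P.phi x - P.psi x)

theorem Admissible.f_ne_top (hP : P.Admissible) {x : Vec n} (hx : x ∈ P.feasible) :
    P.f x ≠ ⊤ := by
  obtain ⟨O, -, -, hO, hf, -⟩ := hP.f_smooth
  exact hf x (hO hx)

theorem Admissible.F_eq (hP : P.Admissible) {x : Vec n} (hx : x ∈ P.feasible) :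
    P.F x = (P.realObjective x : EReal) := by
  have h1 : indicatorFn (nonposOrthant m) (P.g x) = 0 := if_pos hx
  rw [F, h1, add_zero, realObjective, EReal.coe_add,
    EReal.coe_toReal (hP.f_ne_top hx) (hP.f_ne_bot x)]

theorem isClosed_nonposOrthant (m : ℕ) : IsClosed (nonposOrthant m) := by
  have : nonposOrthant m = ⋂ i, {w : Vec m | w i ≤ 0} := by
    ext w; simp [nonposOrthant]
  rw [this]
  exact isClosed_iInter fun i => isClosed_le (by fun_prop) continuous_const

theorem convex_nonposOrthant (m : ℕ) : Convex ℝ (nonposOrthant m) := by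
  intro x hx y hy a b ha hb _ i
  have h1 := mul_nonpos_of_nonneg_of_nonpos ha (hx i)
  have h2 := mul_nonpos_of_nonneg_of_nonpos hb (hy i)
  simpa using add_nonpos h1 h2

theorem Admissible.isClosed_feasible (hP : P.Admissible) : IsClosed P.feasible :=
  (isClosed_nonposOrthant m).preimage hP.g_differentiable.continuous

/-- A closed ε-thickening A of the compact set of feasible points of norm at most R still lies in O,
and the segments joining points of A sweep out a compact subset of the convex set O, on which the
gradient is Lipschitz and bounded. The alternative dist y x ≤ ε serves the exact subproblem
solutions, which need not be feasible for the original problem. -/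
theorem Admissible.exists_f_bounds (hP : P.Admissible) (R : ℝ) :
    ∃ ε > 0, ∃ C, 0 ≤ C ∧ ∀ x ∈ P.feasible, ‖x‖ ≤ R → ‖P.gradf x‖ ≤ C ∧
      ∀ y, (dist y x ≤ ε ∨ (y ∈ P.feasible ∧ ‖y‖ ≤ R)) →
        HasGradientAt (fun x => (P.f x).toReal) (P.gradf y) y ∧ (∀ᶠ y' in 𝓝 y, P.f y' ≠ ⊤) ∧
        |(P.f y).toReal - (P.f x).toReal - ⟪P.gradf x, y - x⟫_ℝ| ≤ C * ‖y - x‖ ^ 2 ∧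
        ‖P.gradf y - P.gradf x‖ ≤ C * ‖y - x‖ := by
  obtain ⟨O, hO, hOc, hΓ, hf, hd, hl⟩ := hP.f_smooth
  have hgrad : ∀ y ∈ O, HasGradientAt (fun x => (P.f x).toReal) (P.gradf y) y := fun y hy =>
    (hd.differentiableAt (hO.mem_nhds hy)).hasGradientAt
  have hK : IsCompact (P.feasible ∩ Metric.closedBall 0 R) :=
    (isCompact_closedBall 0 R).inter_left hP.isClosed_feasible
  obtain ⟨ε, hε, hεO⟩ :=
    hK.exists_cthickening_subset_open hO (Set.inter_subset_left.trans hΓ)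
  set A := Metric.cthickening ε (P.feasible ∩ Metric.closedBall 0 R) with hA
  have hAc : IsCompact A := hK.cthickening
  let S : Set (Vec n) := (fun z : Vec n × Vec n × ℝ => z.1 + z.2.2 • (z.2.1 - z.1)) ''
    (A ×ˢ A ×ˢ Set.Icc 0 1)
  have hSc : IsCompact S := (hAc.prod (hAc.prod isCompact_Icc)).image (by fun_prop)
  have hseg : ∀ x ∈ A, ∀ y ∈ A, segment ℝ x y ⊆ S := by
    intro x hx y hy z hz
    rw [segment_eq_image'] at hz
    obtain ⟨t, ht, rfl⟩ := hz
    exact ⟨(x, y, t), ⟨hx, hy, ht⟩, rfl⟩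
  have hSO : S ⊆ O := by
    rintro _ ⟨⟨x, y, t⟩, ⟨hx, hy, ht⟩, rfl⟩
    exact hOc.add_smul_sub_mem (hεO hx) (hεO hy) ht
  obtain ⟨C₁, hC₁⟩ := (hl.mono hSO).exists_lipschitzOnWith_of_compact hSc
  obtain ⟨C₂, hC₂⟩ := hSc.exists_bound_of_continuousOn (hl.mono hSO).continuousOn
  have hA1 : ∀ x ∈ P.feasible, ‖x‖ ≤ R → x ∈ A := fun x hx hxR =>
    Metric.self_subset_cthickening _ ⟨hx, by simpa using hxR⟩
  refine ⟨ε, hε, max (C₁ : ℝ) (max C₂ 0), le_max_of_le_right (le_max_right _ _), fun x hx hxR => ?_⟩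
  have hxA := hA1 x hx hxR
  refine ⟨(hC₂ x (hseg x hxA x hxA (left_mem_segment ℝ x x))).trans
    (le_max_of_le_right (le_max_left _ _)), fun y hy => ?_⟩
  have hyA : y ∈ A := by
    rcases hy with hy | hy
    · exact Metric.mem_cthickening_of_dist_le y x ε _ ⟨hx, by simpa using hxR⟩ hy
    · exact hA1 y hy.1 hy.2
  have hsub := hseg x hxA y hyA
  have hlip : ∀ z ∈ segment ℝ x y, ‖P.gradf z - P.gradf x‖ ≤ max (C₁ : ℝ) (max C₂ 0) * ‖z - x‖ := by
    intro z hz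
    have := hC₁.dist_le_mul z (hsub hz) x (hsub (left_mem_segment ℝ x y))
    rw [dist_eq_norm, dist_eq_norm] at this
    refine this.trans ?_
    gcongr
    exact le_max_left _ _
  refine ⟨hgrad y (hεO hyA), ?_, ?_, hlip y (right_mem_segment ℝ x y)⟩
  · filter_upwards [hO.mem_nhds (hεO hyA)] with y' hy' using hf y' hy'
  · have := norm_sub_sub_le_of_hasFDerivAt_segment (h := fun x => (P.f x).toReal)
      (h' := fun z => InnerProductSpace.toDual ℝ (Vec n) (P.gradf z)) (C := max (C₁ : ℝ) (max C₂ 0))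
      (x := x) (y := y) (le_max_of_le_right (le_max_right _ _))
      (fun z hz => (hgrad z (hSO (hsub hz))).hasFDerivAt)
      (fun z hz => by
        rw [← map_sub, LinearIsometryEquiv.norm_map]
        exact hlip z hz)
    simpa using this

/-- The Lipschitz constant of g' on the ball of radius R + 1 serves for both bounds; the larger
radius makes that ball a neighbourhood of x, so the constant also bounds the second derivative. -/
theorem Admissible.exists_g_bounds (hP : P.Admissible) (R : ℝ) :
    ∃ C, 0 ≤ C ∧ ∀ x, ‖x‖ ≤ R → ‖fderiv ℝ (fderiv ℝ P.g) x‖ ≤ C ∧ ∀ y, ‖y‖ ≤ R →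
      ‖P.g y - P.g x - fderiv ℝ P.g x (y - x)‖ ≤ C * ‖y - x‖ ^ 2 := by
  obtain ⟨C, hC⟩ := (hP.g_locallyLipschitz.locallyLipschitzOn
    (s := Metric.closedBall 0 (R + 1))).exists_lipschitzOnWith_of_compact (isCompact_closedBall _ _)
  refine ⟨C, C.2, fun x hx => ⟨?_, fun y hy => ?_⟩⟩
  · exact norm_fderiv_le_of_lipschitzOn ℝ
      (Metric.closedBall_mem_nhds_of_mem (by rw [mem_ball_zero_iff]; linarith)) hC
  · have hsub : segment ℝ x y ⊆ Metric.closedBall 0 (R + 1) :=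
      (convex_closedBall 0 (R + 1)).segment_subset
        (by rw [mem_closedBall_zero_iff]; linarith) (by rw [mem_closedBall_zero_iff]; linarith)
    refine norm_sub_sub_le_of_hasFDerivAt_segment C.2
      (fun z _ => (hP.g_differentiable z).hasFDerivAt) (fun z hz => ?_)
    have := hC.dist_le_mul z (hsub hz) x (hsub (left_mem_segment ℝ x y))
    rwa [dist_eq_norm, dist_eq_norm] at this

end DCProblem

section ConvexBounds

variable {n : ℕ}

theorem ConvexOn.exists_norm_subgradient_le {h : Vec n → ℝ} (hh : ConvexOn ℝ Set.univ h) (R : ℝ) :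
    ∃ K, 0 ≤ K ∧ ∀ x, ‖x‖ ≤ R → ∀ v, (∀ y, h x + ⟪v, y - x⟫_ℝ ≤ h y) → ‖v‖ ≤ K := by
  obtain ⟨K, hK⟩ := (hh.locallyLipschitz.locallyLipschitzOn
    (s := Metric.closedBall 0 (R + 1))).exists_lipschitzOnWith_of_compact (isCompact_closedBall _ _)
  refine ⟨K, K.2, fun x hx v hv => ?_⟩
  refine (norm_le_of_subgradient one_pos (K := K) (fun y hy => ?_) hv).trans (max_le le_rfl K.2)
  have hy' : ‖y‖ ≤ R + 1 := by
    have : ‖y‖ ≤ ‖x‖ + dist y x := by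
      rw [dist_eq_norm]
      simpa using norm_add_le x (y - x)
    linarith
  refine (le_abs_self _).trans (hK.dist_le_mul y (by simpa using hy') x ?_)
  rw [mem_closedBall_zero_iff]; linarith

theorem ConvexOn.exists_subgradient {h : Vec n → ℝ} (hh : ConvexOn ℝ Set.univ h) (x : Vec n) :
    ∃ v : Vec n, ∀ y, h x + ⟪v, y - x⟫_ℝ ≤ h y := by
  obtain ⟨v, hv, -⟩ := hh.exists_subgradient_of_forall_nonneg hh.locallyLipschitz.continuous
    (convex_singleton x) (a := 0) rfl (by rintro _ rfl; simp)
  exact ⟨v, hv⟩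

end ConvexBounds

/-! ### The subproblem objective as a model of the objective. -/

namespace DCProblem

variable {n m : ℕ} {P : DCProblem n m}

theorem G_self (s : Vec n) (L : Vec m) : P.G s s L = P.g s := by simp [G]

theorem subObjective_sub (s xi : Vec n) (Q : Vec n →L[ℝ] Vec n) (z w : Vec n) :
    P.subObjective s xi Q z - P.subObjective s xi Q w =
      ⟪P.gradf s + xi, z - w⟫_ℝ + 1 / 2 * ⟪z - s, Q (z - s)⟫_ℝ - 1 / 2 * ⟪w - s, Q (w - s)⟫_ℝ
        + P.phi z - P.phi w := by
  simp only [subObjective, vartheta, inner_sub_right ((P.gradf s) + xi)]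
  ring

theorem subObjective_self (s xi : Vec n) (Q : Vec n →L[ℝ] Vec n) :
    P.subObjective s xi Q s = P.realObjective s := by
  simp only [subObjective, vartheta, realObjective, sub_self, map_zero, inner_zero_right]
  ring

/-- With φ bounded below by its affine minorant at s, the quadratic term μ/2 ‖z − s‖² must be
compensated by linear terms of size (C + K) ‖z − s‖. -/
theorem norm_sub_le_of_subObjective_le {s xi z v : Vec n} {Q : Vec n →L[ℝ] Vec n} {μ C K : ℝ}
    (hμ : 0 < μ) (hQ : ∀ z, μ * ‖z‖ ^ 2 ≤ ⟪z, Q z⟫_ℝ) (hC : ‖P.gradf s + xi‖ ≤ C)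
    (hv : ∀ y, P.phi s + ⟪v, y - s⟫_ℝ ≤ P.phi y) (hK : ‖v‖ ≤ K)
    (h : P.subObjective s xi Q z ≤ P.subObjective s xi Q s) : ‖z - s‖ ≤ 2 * (C + K) / μ := by
  have h1 := P.subObjective_sub s xi Q z s
  simp only [sub_self, map_zero, inner_zero_right, mul_zero] at h1
  have h2 := hQ (z - s)
  have h3 := hv z
  have h4 := (abs_le.1 ((abs_real_inner_le_norm (P.gradf s + xi) (z - s)).trans
    (mul_le_mul_of_nonneg_right hC (norm_nonneg _)))).1
  have h5 := (abs_le.1 ((abs_real_inner_le_norm v (z - s)).trans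
    (mul_le_mul_of_nonneg_right hK (norm_nonneg _)))).1
  rcases (norm_nonneg (z - s)).eq_or_lt with h0 | h0
  · rw [← h0]
    have := (norm_nonneg _).trans hC
    have := (norm_nonneg _).trans hK
    positivity
  rw [le_div_iff₀ hμ]
  refine le_of_mul_le_mul_right ?_ h0
  nlinarith

/-- The model majorizes the objective up to the Taylor error of f, because ξ is a supergradient of
the concave function −ψ. -/
theorem realObjective_le_subObjective {s xi z : Vec n} {Q : Vec n →L[ℝ] Vec n} {C : ℝ}
    (hf : |(P.f z).toReal - (P.f s).toReal - ⟪P.gradf s, z - s⟫_ℝ| ≤ C * ‖z - s‖ ^ 2)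
    (hψ : P.psi s - ⟪xi, z - s⟫_ℝ ≤ P.psi z) :
    P.realObjective z ≤ P.subObjective s xi Q z - 1 / 2 * ⟪z - s, Q (z - s)⟫_ℝ
      + C * ‖z - s‖ ^ 2 := by
  have h1 := P.subObjective_sub s xi Q z s
  rw [subObjective_self] at h1
  simp only [sub_self, map_zero, inner_zero_right, mul_zero, inner_add_left] at h1
  have h2 := (abs_le.1 hf).2
  simp only [realObjective] at h1 ⊢
  linarith

end DCProblem

/-! ### Boundedness of the iterates and of the inner-loop parameters. -/

namespace MBATrace

open DCProblem

variable {n m : ℕ} {P : DCProblem n m} {p : MBAParams} {T : MBATrace n m}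

theorem IsRun.x_mem (h : T.IsRun P p) (k : ℕ) : T.x k ∈ P.feasible := by
  cases k with
  | zero => exact h.init
  | succ k => rw [h.step]; exact (h.accepts k).1

theorem IsRun.realObjective_decrease (h : T.IsRun P p) (hP : P.Admissible) (k : ℕ) :
    p.alpha / 2 * ‖T.x (k + 1) - T.x k‖ ^ 2
      ≤ P.realObjective (T.x k) - P.realObjective (T.x (k + 1)) := by
  have h1 := (h.accepts k).2
  rw [← h.step, hP.F_eq (h.x_mem _), hP.F_eq (h.x_mem _), ← EReal.coe_sub,
    EReal.coe_le_coe_iff] at h1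
  linarith

theorem IsRun.psi_le (h : T.IsRun P p) (hP : P.Admissible) (k : ℕ) (y : Vec n) :
    P.psi (T.x k) - ⟪T.xi k, y - T.x k⟫_ℝ ≤ P.psi y :=
  hP.psi_convex.le_of_mem_limSubdiff_neg hP.psi_convex.locallyLipschitz.continuous (h.xi_mem k) y

theorem IsRun.muMin_le (h : T.IsRun P p) (k : ℕ) : ∀ j ≤ T.jEnd k, p.muMin ≤ T.mu k j := by
  intro j
  induction j with
  | zero => exact fun _ => (h.mu_init k).1
  | succ j ih =>
    intro hj
    have h1 := ih (by omega)
    by_cases hg : P.g (T.y k j) ∈ nonposOrthant m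
    · rw [(h.increase_mu k j hj hg).2]
      have := p.muMin_pos
      have := p.tau_gt_one
      nlinarith
    · rw [(h.increase_L k j hj hg).2]
      exact h1

theorem IsRun.LMin_le (h : T.IsRun P p) (k : ℕ) : ∀ j ≤ T.jEnd k, ∀ i, p.LMin ≤ T.L k j i := by
  intro j
  induction j with
  | zero => exact fun _ i => (h.L_init k i).1
  | succ j ih =>
    intro hj i
    have h1 := ih (by omega) i
    by_cases hg : P.g (T.y k j) ∈ nonposOrthant m
    · rw [(h.increase_mu k j hj hg).1]
      exact h1
    · rw [(h.increase_L k j hj hg).1, PiLp.smul_apply, smul_eq_mul]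
      have := p.LMin_pos
      have := p.tau_gt_one
      nlinarith

/-- All components of L are multiplied by the same factor τ, so their initial ratios persist. A
bound on one component thereby bounds them all. -/
theorem IsRun.L_le_mul (h : T.IsRun P p) (k : ℕ) :
    ∀ j ≤ T.jEnd k, ∀ i i', T.L k j i ≤ p.LMax / p.LMin * T.L k j i' := by
  intro j
  induction j with
  | zero =>
    intro _ i i'
    have := p.LMin_pos
    have h3 : 0 < p.LMax := this.trans_le p.LMin_le
    rw [div_mul_eq_mul_div, le_div_iff₀ this]
    have h1 := h.L_init k i
    have h2 := h.L_init k i'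
    exact mul_le_mul h1.2 h2.1 this.le h3.le
  | succ j ih =>
    intro hj i i'
    have h1 := ih (by omega) i i'
    by_cases hg : P.g (T.y k j) ∈ nonposOrthant m
    · rw [(h.increase_mu k j hj hg).1]
      exact h1
    · rw [(h.increase_L k j hj hg).1, PiLp.smul_apply, PiLp.smul_apply, smul_eq_mul, smul_eq_mul]
      have := mul_le_mul_of_nonneg_left h1 (zero_le_one.trans p.tau_gt_one.le)
      linarith

theorem IsRun.mul_norm_sq_le_inner_Q (h : T.IsRun P p) {k j : ℕ} (hj : j ≤ T.jEnd k) (z : Vec n) :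
    T.mu k j * ‖z‖ ^ 2 ≤ ⟪z, T.Q k j z⟫_ℝ := by
  have := (h.Q_lower k j hj).inner_nonneg_right z
  simp only [_root_.sub_apply, _root_.smul_apply,
    ContinuousLinearMap.id_apply, inner_sub_right, real_inner_smul_right,
    real_inner_self_eq_norm_sq] at this
  linarith

theorem IsRun.inner_Q_le_mul_norm_sq (h : T.IsRun P p) {k j : ℕ} (hj : j ≤ T.jEnd k) (z : Vec n) :
    ⟪z, T.Q k j z⟫_ℝ ≤ (T.mu k j + p.M) * ‖z‖ ^ 2 := by
  have := (h.Q_upper k j hj).inner_nonneg_right z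
  simp only [_root_.sub_apply, _root_.smul_apply,
    ContinuousLinearMap.id_apply, inner_sub_right, real_inner_smul_right,
    real_inner_self_eq_norm_sq] at this
  linarith

theorem IsRun.Q_isPositive (h : T.IsRun P p) {k j : ℕ} (hj : j ≤ T.jEnd k) :
    (T.Q k j).IsPositive := by
  have h1 : 0 ≤ T.mu k j := p.muMin_pos.le.trans (h.muMin_le k j hj)
  have := (h.Q_lower k j hj).add
    ((ContinuousLinearMap.isPositive_id (𝕜 := ℝ) (E := Vec n)).smul_of_nonneg h1)
  simpa using this

theorem IsRun.norm_Q_apply_le (h : T.IsRun P p) {k j : ℕ} (hj : j ≤ T.jEnd k) (z : Vec n) :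
    ‖T.Q k j z‖ ≤ (T.mu k j + p.M) * ‖z‖ :=
  norm_apply_le_of_isPositive (h.Q_isPositive hj).inner_nonneg_right
    (h.Q_isPositive hj).inner_left_eq_inner_right (h.inner_Q_le_mul_norm_sq hj) z

theorem IsRun.G_y_le (h : T.IsRun P p) {k j : ℕ} (hj : j ≤ T.jEnd k) (i : Fin m) :
    P.G (T.y k j) (T.x k) (T.L k j) i ≤ p.betaR / 2 * ‖T.y k j - T.x k‖ ^ 2 := by
  have h1 := h.inexact_residual k j hj
  set w : Fin m → ℝ := fun i => max (P.G (T.y k j) (T.x k) (T.L k j) i) 0 with hw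
  have h2 : w i ≤ ‖w‖ := (le_abs_self _).trans (norm_le_pi_norm w i)
  have h3 : ‖w‖ ≤ P.residual (T.x k) (T.xi k) (T.Q k j) (T.L k j) (T.y k j) (T.v k j)
      (T.lam k j) := by
    refine le_add_of_nonneg_left ?_
    positivity
  exact (le_max_left _ _).trans (h2.trans (h3.trans h1))

theorem IsRun.exists_norm_xi_le (h : T.IsRun P p) (hP : P.Admissible)
    (hbdd : Bornology.IsBounded (Set.range T.x)) : ∃ K, 0 ≤ K ∧ ∀ k, ‖T.xi k‖ ≤ K := by
  obtain ⟨R, hR⟩ := hbdd.exists_norm_le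
  obtain ⟨K, hK0, hK⟩ := hP.psi_convex.exists_norm_subgradient_le R
  refine ⟨K, hK0, fun k => ?_⟩
  rw [← norm_neg]
  refine hK (T.x k) (hR _ ⟨k, rfl⟩) _ fun y => ?_
  have := h.psi_le hP k y
  rwa [inner_neg_left, ← sub_eq_add_neg]

/-- Both y and x̄ have model value at most that of x^k (for x̄ because x^k is feasible for the
subproblem), so they stay at bounded distance from x^k. -/
theorem IsRun.exists_norm_iterates_le (h : T.IsRun P p) (hP : P.Admissible)
    (hbdd : Bornology.IsBounded (Set.range T.x)) :
    ∃ R, 0 ≤ R ∧ ∀ k, ‖T.x k‖ ≤ R ∧ ∀ j ≤ T.jEnd k, ‖T.y k j‖ ≤ R ∧ ‖T.xbar k j‖ ≤ R := by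
  obtain ⟨R, hR⟩ := hbdd.exists_norm_le
  have hR' : ∀ k, ‖T.x k‖ ≤ R := fun k => hR _ ⟨k, rfl⟩
  obtain ⟨Kξ, hKξ0, hKξ⟩ := h.exists_norm_xi_le hP hbdd
  obtain ⟨K, hK0, hK⟩ := hP.phi_convex.exists_norm_subgradient_le R
  obtain ⟨_, _, C, hC0, hC⟩ := hP.exists_f_bounds R
  have hR0 : 0 ≤ R := (norm_nonneg _).trans (hR' 0)
  have key : ∀ k, ∀ j ≤ T.jEnd k, ∀ z,
      P.subObjective (T.x k) (T.xi k) (T.Q k j) z ≤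
        P.subObjective (T.x k) (T.xi k) (T.Q k j) (T.x k) →
      ‖z‖ ≤ R + 2 * (C + Kξ + K) / p.muMin := by
    intro k j hj z hz
    obtain ⟨v, hv⟩ := hP.phi_convex.exists_subgradient (T.x k)
    have h1 := norm_sub_le_of_subObjective_le (C := C + Kξ) (μ := p.muMin) p.muMin_pos
      (fun z => le_trans (by gcongr; exact h.muMin_le k j hj) (h.mul_norm_sq_le_inner_Q hj z))
      ((norm_add_le _ _).trans (add_le_add (hC _ (h.x_mem k) (hR' k)).1 (hKξ k))) hv
      (hK _ (hR' k) v hv) hz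
    have h2 := norm_add_le (T.x k) (z - T.x k)
    rw [add_sub_cancel] at h2
    exact h2.trans (add_le_add (hR' k) h1)
  have hμ := p.muMin_pos
  refine ⟨R + 2 * (C + Kξ + K) / p.muMin, by positivity, fun k => ⟨(hR' k).trans ?_,
    fun j hj => ⟨key k j hj _ (h.inexact_descent k j hj), key k j hj _ (h.xbar_min k j hj ?_)⟩⟩⟩
  · exact le_add_of_nonneg_right (by positivity)
  · change P.G (T.x k) (T.x k) (T.L k j) ∈ nonposOrthant m
    rw [G_self]
    exact h.x_mem k

/-- A parameter is increased only after a failed test, and a failed test is possible only while the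
parameter is small. If y is feasible, the majorization gives F(y) ≤ F(x^k) − (μ/2 − C_f) ‖y − x^k‖²,
so failure forces μ < 2 C_f + α. If g_i(y) > 0, Taylor expansion and the residual bound on G_i force
L_i < 2 C_g + β_R. One further factor τ bounds the value after the increase. -/
theorem IsRun.exists_mu_L_le (h : T.IsRun P p) (hP : P.Admissible)
    (hbdd : Bornology.IsBounded (Set.range T.x)) :
    ∃ U, 0 ≤ U ∧ ∀ k, ∀ j ≤ T.jEnd k, T.mu k j ≤ U ∧ ∀ i, T.L k j i ≤ U := by
  obtain ⟨R, hR0, hR⟩ := h.exists_norm_iterates_le hP hbdd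
  obtain ⟨_, _, Cf, hCf0, hCf⟩ := hP.exists_f_bounds R
  obtain ⟨Cg, hCg0, hCg⟩ := hP.exists_g_bounds R
  have hτ : 0 < p.tau := zero_lt_one.trans p.tau_gt_one
  have hLm := p.LMin_pos
  have hLM : 0 < p.LMax := hLm.trans_le p.LMin_le
  have hμM : 0 < p.muMax := p.muMin_pos.trans_le p.muMin_le
  have hα := p.alpha_pos
  have hβ := p.betaR_pos
  have hmu : ∀ k, ∀ j ≤ T.jEnd k, T.mu k j ≤ p.muMax + p.tau * (2 * Cf + p.alpha) := by
    intro k j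
    induction j with
    | zero => exact fun _ => (h.mu_init k).2.trans (le_add_of_nonneg_right (by positivity))
    | succ j ih =>
      intro hj
      have hj' : j ≤ T.jEnd k := by omega
      by_cases hg : P.g (T.y k j) ∈ nonposOrthant m
      · rw [(h.increase_mu k j hj hg).2]
        have hlt : T.mu k j < 2 * Cf + p.alpha := by
          by_contra hcon
          push Not at hcon
          refine h.not_accepts k j hj ⟨hg, ?_⟩
          have hg' : T.y k j ∈ P.feasible := hg
          rw [hP.F_eq hg', hP.F_eq (h.x_mem k), ← EReal.coe_sub, EReal.coe_le_coe_iff]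
          have h1 := realObjective_le_subObjective (Q := T.Q k j)
            ((hCf _ (h.x_mem k) (hR k).1).2 (T.y k j)
              (Or.inr ⟨hg, ((hR k).2 j hj').1⟩)).2.2.1 (h.psi_le hP k (T.y k j))
          have h2 := h.inexact_descent k j hj'
          rw [subObjective_self] at h2
          have h3 := h.mul_norm_sq_le_inner_Q hj' (T.y k j - T.x k)
          have h4 := mul_le_mul_of_nonneg_right hcon (sq_nonneg ‖T.y k j - T.x k‖)
          linarith
        have := mul_le_mul_of_nonneg_left hlt.le hτ.le
        linarith
      · rw [(h.increase_L k j hj hg).2]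
        exact ih (by omega)
  have hL : ∀ k, ∀ j ≤ T.jEnd k, ∀ i,
      T.L k j i ≤ p.LMax + p.tau * (p.LMax / p.LMin * (2 * Cg + p.betaR)) := by
    intro k j
    induction j with
    | zero => exact fun _ i => (h.L_init k i).2.trans (le_add_of_nonneg_right (by positivity))
    | succ j ih =>
      intro hj i
      have hj' : j ≤ T.jEnd k := by omega
      by_cases hg : P.g (T.y k j) ∈ nonposOrthant m
      · rw [(h.increase_mu k j hj hg).1]
        exact ih (by omega) i
      · rw [(h.increase_L k j hj hg).1, PiLp.smul_apply, smul_eq_mul]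
        obtain ⟨i', hi'⟩ : ∃ i', 0 < P.g (T.y k j) i' := by
          by_contra hcon
          push Not at hcon
          exact hg hcon
        have hlt : T.L k j i' < 2 * Cg + p.betaR := by
          by_contra hcon
          push Not at hcon
          have h1 := (hCg (T.x k) (hR k).1).2 (T.y k j) ((hR k).2 j hj').1
          have h2 := ((le_abs_self _).trans (PiLp.norm_apply_le (P.g (T.y k j) - P.g (T.x k)
            - fderiv ℝ P.g (T.x k) (T.y k j - T.x k)) i')).trans h1
          have h3 := h.G_y_le hj' i'
          simp only [G, PiLp.add_apply, PiLp.sub_apply, PiLp.smul_apply, smul_eq_mul] at h2 h3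
          have h4 := mul_le_mul_of_nonneg_right hcon (sq_nonneg ‖T.y k j - T.x k‖)
          linarith
        have h5 : T.L k j i ≤ p.LMax / p.LMin * (2 * Cg + p.betaR) :=
          (h.L_le_mul k j hj' i i').trans (by gcongr)
        have := mul_le_mul_of_nonneg_left h5 hτ.le
        linarith
  refine ⟨(p.muMax + p.tau * (2 * Cf + p.alpha)) +
    (p.LMax + p.tau * (p.LMax / p.LMin * (2 * Cg + p.betaR))), by positivity, fun k j hj =>
      ⟨(hmu k j hj).trans (le_add_of_nonneg_right (by positivity)),
        fun i => (hL k j hj i).trans (le_add_of_nonneg_left (by positivity))⟩⟩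

end MBATrace

/-! ### Convexity, KKT points and error bounds for the subproblems. -/

namespace DCProblem

variable {n m : ℕ} {P : DCProblem n m}

/-- The derivative of `G` in its first argument. -/
noncomputable def derivG (P : DCProblem n m) (x s : Vec n) (L : Vec m) : Vec n →L[ℝ] Vec m :=
  fderiv ℝ P.g s + (innerSL ℝ (x - s)).smulRight L

theorem derivG_apply (x s d : Vec n) (L : Vec m) :
    P.derivG x s L d = fderiv ℝ P.g s d + ⟪x - s, d⟫_ℝ • L := rfl

theorem hasFDerivAt_G (x s : Vec n) (L : Vec m) :
    HasFDerivAt (fun x' => P.G x' s L) (P.derivG x s L) x := by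
  have h1 : HasFDerivAt (fun x' : Vec n => x' - s) (ContinuousLinearMap.id ℝ (Vec n)) x :=
    (hasFDerivAt_id x).sub_const s
  have h2 := ((fderiv ℝ P.g s).hasFDerivAt.comp x h1).const_add (P.g s)
  have h3 := (h1.norm_sq.const_mul (1 / 2)).smul_const L
  refine (h2.add h3).congr_fderiv ?_
  ext d : 1
  simp [derivG_apply, inner_sub_left]

theorem G_sub (y x s : Vec n) (L : Vec m) :
    P.G y s L - P.G x s L = P.derivG x s L (y - x) + (1 / 2 * ‖y - x‖ ^ 2) • L := by
  have h1 : fderiv ℝ P.g s (y - x) = fderiv ℝ P.g s (y - s) - fderiv ℝ P.g s (x - s) := by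
    rw [← map_sub, sub_sub_sub_cancel_right]
  have h2 : ‖y - s‖ ^ 2 = ‖x - s‖ ^ 2 + 2 * ⟪x - s, y - x⟫_ℝ + ‖y - x‖ ^ 2 := by
    rw [← norm_add_sq_real]; congr 2; abel
  rw [derivG_apply, h1, G, G, h2]
  module

/-- G is expanded exactly around the convex combination z: the linear terms at x and y cancel after
weighting, and the quadratic remainders are nonnegative. -/
theorem convex_subFeasible (s : Vec n) {L : Vec m} (hL : ∀ i, 0 ≤ L i) :
    Convex ℝ (P.subFeasible s L) := by
  intro x hx y hy a b ha hb hab i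
  have hb' : b = 1 - a := by linarith
  set z := a • x + b • y with hz
  have e1 := congrArg (fun w : Vec m => w i) (P.G_sub x z s L)
  have e2 := congrArg (fun w : Vec m => w i) (P.G_sub y z s L)
  simp only [PiLp.sub_apply, PiLp.add_apply, PiLp.smul_apply, smul_eq_mul] at e1 e2
  have e3 : a * P.derivG z s L (x - z) i + b * P.derivG z s L (y - z) i = 0 := by
    have : a • (x - z) + b • (y - z) = 0 := by
      rw [hz, hb']; module
    have := congrArg (fun w => P.derivG z s L w i) this
    simpa using this
  have h1 := mul_nonpos_of_nonneg_of_nonpos ha (hx i)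
  have h2 := mul_nonpos_of_nonneg_of_nonpos hb (hy i)
  have h3 : 0 ≤ a * (1 / 2 * ‖x - z‖ ^ 2 * L i) := by have := hL i; positivity
  have h4 : 0 ≤ b * (1 / 2 * ‖y - z‖ ^ 2 * L i) := by have := hL i; positivity
  have e4 : P.G z s L i = a * P.G z s L i + b * P.G z s L i := by rw [← add_mul, hab, one_mul]
  rw [e4]
  have e5 := congrArg (a * ·) e1
  have e6 := congrArg (b * ·) e2
  linarith

theorem subObjective_sub_eq_of_symm {s xi : Vec n} {Q : Vec n →L[ℝ] Vec n}
    (hQ : ∀ x y, ⟪Q x, y⟫_ℝ = ⟪x, Q y⟫_ℝ) (y x : Vec n) :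
    P.subObjective s xi Q y - P.subObjective s xi Q x =
      ⟪P.gradf s + xi + Q (x - s), y - x⟫_ℝ + 1 / 2 * ⟪y - x, Q (y - x)⟫_ℝ
        + P.phi y - P.phi x := by
  rw [subObjective_sub]
  have h1 : y - s = (x - s) + (y - x) := by abel
  have h2 := hQ (x - s) (y - x)
  have h3 : ⟪y - x, Q (x - s)⟫_ℝ = ⟪Q (x - s), y - x⟫_ℝ := real_inner_comm _ _
  rw [h1]
  simp only [map_add, inner_add_left, inner_add_right]
  linarith

/-- Karush–Kuhn–Tucker points of the subproblems, the multiplier of `φ` included. -/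
structure IsKKT (P : DCProblem n m) (s xi : Vec n) (Q : Vec n →L[ℝ] Vec n) (L : Vec m)
    (x v : Vec n) (lam : Vec m) : Prop where
  subgradient : ∀ y, P.phi x + ⟪v, y - x⟫_ℝ ≤ P.phi y
  stationary : ∀ d, ⟪P.gradf s + xi + Q (x - s) + v, d⟫_ℝ + ⟪lam, P.derivG x s L d⟫_ℝ = 0
  inner_nonpos : ∀ w ∈ nonposOrthant m, ⟪lam, w⟫_ℝ ≤ 0
  complementary : ⟪lam, P.G x s L⟫_ℝ = 0

/-- Subtracting c times the all-ones vector moves w into the nonpositive orthant. -/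
theorem inner_le_of_forall_apply_le {lam : Vec m} (hlam : ∀ w ∈ nonposOrthant m, ⟪lam, w⟫_ℝ ≤ 0)
    {w : Vec m} {c : ℝ} (hc : 0 ≤ c) (hw : ∀ i, w i ≤ c) :
    ⟪lam, w⟫_ℝ ≤ ‖lam‖ * ‖(WithLp.toLp 2 fun _ => 1 : Vec m)‖ * c := by
  have h1 := hlam (w - c • (WithLp.toLp 2 fun _ => 1 : Vec m)) (fun i => by simpa using hw i)
  rw [inner_sub_right, real_inner_smul_right] at h1
  have h2 := mul_le_mul_of_nonneg_left
    (real_inner_le_norm lam (WithLp.toLp 2 fun _ => 1 : Vec m)) hc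
  linarith

/-- The distance of an inexact solution of a subproblem to the exact one. -/
theorem IsKKT.mul_norm_sub_sq_le {s xi x v : Vec n} {Q : Vec n →L[ℝ] Vec n} {L lam : Vec m}
    (h : P.IsKKT s xi Q L x v lam) (hQ : ∀ x y, ⟪Q x, y⟫_ℝ = ⟪x, Q y⟫_ℝ) {μ : ℝ}
    (hμ : ∀ z, μ * ‖z‖ ^ 2 ≤ ⟪z, Q z⟫_ℝ) (hL : ∀ i, 0 ≤ L i) {y : Vec n} {c : ℝ} (hc : 0 ≤ c)
    (hy : ∀ i, P.G y s L i ≤ c) :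
    μ / 2 * ‖y - x‖ ^ 2 ≤ P.subObjective s xi Q y - P.subObjective s xi Q x
      + ‖lam‖ * ‖(WithLp.toLp 2 fun _ => 1 : Vec m)‖ * c := by
  have h1 := P.subObjective_sub_eq_of_symm (xi := xi) (s := s) hQ y x
  have h2 := h.subgradient y
  have h3 := h.stationary (y - x)
  have h4 := inner_le_of_forall_apply_le h.inner_nonpos hc hy
  -- By complementarity, ⟨λ, G(y)⟩ is the first-order term plus a nonnegative curvature term. The
  -- former cancels the gradient of the objective by stationarity; what remains on the objective
  -- side is the quadratic form of Q, which supplies the growth.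
  have h5 : P.G y s L = P.G x s L + (P.derivG x s L (y - x) + (1 / 2 * ‖y - x‖ ^ 2) • L) := by
    rw [← G_sub]; abel
  have h6 : 0 ≤ ⟪lam, L⟫_ℝ := by
    have := h.inner_nonpos (-L) (fun i => by simpa using hL i)
    rw [inner_neg_right] at this
    linarith
  have h7 : 0 ≤ 1 / 2 * ‖y - x‖ ^ 2 * ⟪lam, L⟫_ℝ := by positivity
  rw [h5, inner_add_right, inner_add_right, real_inner_smul_right, h.complementary] at h4
  rw [inner_add_left] at h3
  have h8 := hμ (y - x)
  linarith

/-- First-order optimality of the exact solution of a subproblem. -/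
theorem exists_subgradient_of_isMinOn (hφ : ConvexOn ℝ Set.univ P.phi) {s xi x : Vec n}
    {Q : Vec n →L[ℝ] Vec n} {L : Vec m} (hQ : Q.IsPositive) (hL : ∀ i, 0 ≤ L i)
    (hx : x ∈ P.subFeasible s L) (hmin : IsMinOn (P.subObjective s xi Q) (P.subFeasible s L) x) :
    ∃ v : Vec n, (∀ y, P.phi x + ⟪v, y - x⟫_ℝ ≤ P.phi y) ∧
      -(P.gradf s + xi + Q (x - s) + v) ∈ normalCone (P.subFeasible s L) x := by
  have hconv := P.convex_subFeasible s hL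
  obtain ⟨v, hv1, hv2⟩ := hφ.exists_subgradient_of_forall_nonneg hφ.locallyLipschitz.continuous
    hconv hx (a := P.gradf s + xi + Q (x - s)) (fun y hy => by
      set A := ⟪P.gradf s + xi + Q (x - s), y - x⟫_ℝ + P.phi y - P.phi x with hA
      set c := ⟪y - x, Q (y - x)⟫_ℝ with hc
      have hc0 : 0 ≤ c := hQ.inner_nonneg_right _
      -- Minimality along the segment towards y, divided by t: A is the first-order increment with φ
      -- kept as a difference, and the quadratic part contributes only t c / 2.
      have key : ∀ t : ℝ, 0 < t → t ≤ 1 → 0 ≤ A + 1 / 2 * t * c := by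
        intro t ht0 ht1
        have h1 := P.subObjective_sub_eq_of_symm (s := s) (xi := xi) hQ.inner_left_eq_inner_right
          (x + t • (y - x)) x
        have h2 : P.subObjective s xi Q x ≤ P.subObjective s xi Q (x + t • (y - x)) :=
          hmin (hconv.add_smul_sub_mem hx hy ⟨ht0.le, ht1⟩)
        have h3 : P.phi (x + t • (y - x)) ≤ (1 - t) * P.phi x + t * P.phi y := by
          have := hφ.2 (Set.mem_univ x) (Set.mem_univ y) (by linarith : 0 ≤ 1 - t) ht0.le (by ring)
          rwa [show (1 - t) • x + t • y = x + t • (y - x) by module] at this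
        rw [add_sub_cancel_left, map_smul, real_inner_smul_right, real_inner_smul_right,
          real_inner_smul_left] at h1
        refine nonneg_of_mul_nonneg_right (a := t) ?_ ht0
        rw [hA]
        linarith
      by_contra hneg
      push Not at hneg
      -- For this t one has t c ≤ −A, so A + t c / 2 ≤ A / 2 < 0, contradicting `key`.
      have h1 := key (min 1 (-A / (c + 1))) (lt_min one_pos (div_pos (by linarith) (by linarith)))
        (min_le_left _ _)
      have h2 : min 1 (-A / (c + 1)) * c ≤ -A / (c + 1) * c := by gcongr; exact min_le_right _ _
      have h3 : -A / (c + 1) * c ≤ -A := by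
        rw [div_mul_eq_mul_div, div_le_iff₀ (by linarith)]
        nlinarith
      linarith)
  refine ⟨v, hv1, mem_normalCone_of_forall_inner_nonpos hx fun y hy => ?_⟩
  rw [inner_neg_left]
  linarith [hv2 y hy]

/-- The orthant is a cone, so testing the normal inequality at 0 and at 2 G(x) forces
complementarity, after which it says that λ is nonpositive on the whole orthant. -/
theorem IsKKT.of_mem_normalCone {s xi x v : Vec n} {Q : Vec n →L[ℝ] Vec n} {L lam : Vec m}
    (hv : ∀ y, P.phi x + ⟪v, y - x⟫_ℝ ≤ P.phi y)
    (hlam : lam ∈ normalCone (nonposOrthant m) (P.G x s L))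
    (hx : P.G x s L ∈ nonposOrthant m)
    (hadj : ContinuousLinearMap.adjoint (fderiv ℝ (fun x' => P.G x' s L) x) lam
      = -(P.gradf s + xi + Q (x - s) + v)) : P.IsKKT s xi Q L x v lam := by
  have hN := (convex_nonposOrthant m).inner_nonpos_of_mem_normalCone hlam
  have h0 : 0 ≤ ⟪lam, P.G x s L⟫_ℝ := by
    have := hN 0 (fun i => by simp)
    rw [zero_sub, inner_neg_right] at this
    linarith
  have h1 : ⟪lam, P.G x s L⟫_ℝ ≤ 0 := by
    have := hN ((2 : ℝ) • P.G x s L) (fun i => by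
      have := hx i
      simp only [PiLp.smul_apply, smul_eq_mul]
      linarith)
    rwa [two_smul, add_sub_cancel_right] at this
  have hc : ⟪lam, P.G x s L⟫_ℝ = 0 := le_antisymm h1 h0
  refine ⟨hv, fun d => ?_, fun w hw => ?_, hc⟩
  · rw [(P.hasFDerivAt_G x s L).fderiv] at hadj
    rw [← ContinuousLinearMap.adjoint_inner_left, hadj, inner_neg_left, add_neg_cancel]
  · have := hN w hw
    rwa [inner_sub_right, hc, sub_zero] at this

end DCProblem

/-! ### Uniformly bounded multipliers and the distance to the exact solutions. -/

namespace MBATrace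

open DCProblem

variable {n m : ℕ} {P : DCProblem n m} {p : MBAParams} {T : MBATrace n m}

theorem norm_le_of_forall_abs_le {w : Vec m} {U : ℝ} (hU : 0 ≤ U) (h : ∀ i, |w i| ≤ U) :
    ‖w‖ ≤ Real.sqrt m * U := by
  rw [EuclideanSpace.norm_eq]
  refine Real.sqrt_le_iff.2 ⟨by positivity, ?_⟩
  rw [mul_pow, Real.sq_sqrt (by positivity)]
  refine (Finset.sum_le_card_nsmul _ _ (U ^ 2) fun i _ => ?_).trans_eq (by simp)
  rw [Real.norm_eq_abs]
  exact pow_le_pow_left₀ (abs_nonneg _) (h i) 2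

theorem IsRun.exists_norm_L_le (h : T.IsRun P p) (hP : P.Admissible)
    (hbdd : Bornology.IsBounded (Set.range T.x)) :
    ∃ U, 0 ≤ U ∧ ∀ k, ‖T.L k (T.jEnd k)‖ ≤ U := by
  obtain ⟨U, hU0, hU⟩ := h.exists_mu_L_le hP hbdd
  refine ⟨Real.sqrt m * U, by positivity, fun k => norm_le_of_forall_abs_le hU0 fun i => ?_⟩
  rw [abs_of_nonneg (p.LMin_pos.le.trans (h.LMin_le k _ le_rfl i))]
  exact (hU k _ le_rfl).2 i

theorem IsRun.exists_norm_Q_le (h : T.IsRun P p) (hP : P.Admissible)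
    (hbdd : Bornology.IsBounded (Set.range T.x)) :
    ∃ U, 0 ≤ U ∧ ∀ k, ‖T.Q k (T.jEnd k)‖ ≤ U := by
  obtain ⟨U, hU0, hU⟩ := h.exists_mu_L_le hP hbdd
  have := p.M_pos
  refine ⟨U + p.M, by positivity, fun k => ContinuousLinearMap.opNorm_le_bound _ (by positivity)
    fun z => (h.norm_Q_apply_le le_rfl z).trans ?_⟩
  gcongr
  exact (hU k _ le_rfl).1

theorem IsRun.u_mem_paramSet (h : T.IsRun P p) (k : ℕ) : T.u k ∈ paramSet n m := by
  refine ⟨fun i => p.LMin_pos.le.trans (h.LMin_le k _ le_rfl i), h.Q_isPositive le_rfl,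
    fun x hx => lt_of_lt_of_le ?_ (h.mul_norm_sq_le_inner_Q le_rfl x)⟩
  have h1 := p.muMin_pos.trans_le (h.muMin_le k _ le_rfl)
  have h2 := norm_pos_iff.2 hx
  positivity

/-- First-order optimality of x̄^k places minus the objective subgradient in the normal cone. Near
each cluster point of (u^k, x̄^k) the bounded multiplier property represents it by a multiplier of
norm at most κ times its own; these subgradients are uniformly bounded, and compactness makes the
constant uniform. -/
theorem IsRun.exists_multiplier_bound (h : T.IsRun P p) (hP : P.Admissible)
    (hbdd : Bornology.IsBounded (Set.range T.x)) (hBMP : T.BMPAtClusterPoints P) :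
    ∃ c, ∀ᶠ k in atTop, ∃ v lam, P.IsKKT (T.x k) (T.xi k) (T.Q k (T.jEnd k)) (T.L k (T.jEnd k))
      (T.xbar k (T.jEnd k)) v lam ∧ ‖lam‖ ≤ c := by
  obtain ⟨R, hR0, hR⟩ := h.exists_norm_iterates_le hP hbdd
  obtain ⟨Kξ, hKξ0, hKξ⟩ := h.exists_norm_xi_le hP hbdd
  obtain ⟨K, hK0, hK⟩ := hP.phi_convex.exists_norm_subgradient_le R
  obtain ⟨_, _, C, hC0, hC⟩ := hP.exists_f_bounds R
  obtain ⟨UL, hUL0, hUL⟩ := h.exists_norm_L_le hP hbdd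
  obtain ⟨UQ, hUQ0, hUQ⟩ := h.exists_norm_Q_le hP hbdd
  have hbdd' : Bornology.IsBounded (Set.range fun k => (T.u k, T.xbar k (T.jEnd k))) := by
    rw [isBounded_iff_forall_norm_le]
    refine ⟨max (max UL (max UQ (max Kξ R))) R, ?_⟩
    rintro _ ⟨k, rfl⟩
    exact max_le_max (max_le_max (hUL k) (max_le_max (hUQ k) (max_le_max (hKξ k) (hR k).1)))
      ((hR k).2 _ le_rfl).2
  have : ProperSpace (Param n m × Vec n) := FiniteDimensional.proper ℝ _
  refine exists_eventually_of_mapClusterPt hbdd' ?_ ?_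
  · rintro c c' k hcc' ⟨v, lam, h1, h2⟩
    exact ⟨v, lam, h1, h2.trans hcc'⟩
  · intro w hw
    obtain ⟨-, -, κ, hκ, 𝒰, h𝒰, 𝒱, h𝒱, hb⟩ := hBMP w hw
    refine ⟨κ * (C + Kξ + UQ * (R + R) + K), 𝒰 ×ˢ 𝒱, ?_, Eventually.of_forall fun k hk => ?_⟩
    · rw [← Prod.mk.eta (p := w)]
      exact prod_mem_nhds h𝒰 h𝒱
    have hxb := h.xbar_mem k _ le_rfl
    obtain ⟨v, hv, hvN⟩ := exists_subgradient_of_isMinOn hP.phi_convex (h.Q_isPositive le_rfl)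
      (h.u_mem_paramSet k).1 hxb (h.xbar_min k _ le_rfl)
    obtain ⟨lam, hlam, hadj, hnorm⟩ := hb (T.u k) ⟨hk.1, h.u_mem_paramSet k⟩ _ hk.2 hxb _ hvN
    refine ⟨v, lam, IsKKT.of_mem_normalCone hv hlam hxb hadj, hnorm.trans ?_⟩
    gcongr
    rw [norm_neg]
    refine norm_add_le_of_le (norm_add_le_of_le (norm_add_le_of_le (hC _ (h.x_mem k) (hR k).1).1
      (hKξ k)) ?_) (hK _ ((hR k).2 _ le_rfl).2 v hv)
    exact (ContinuousLinearMap.le_opNorm _ _).trans (mul_le_mul (hUQ k)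
      (norm_sub_le_of_le ((hR k).2 _ le_rfl).2 (hR k).1) (norm_nonneg _) hUQ0)

/-- `IsKKT.mul_norm_sub_sq_le` is applied with y = x^{k+1}: the objective gap is at most β_F/2 · D²
and the constraint violation at most β_R/2 · D², where D = ‖x^{k+1} − x^k‖, whence ‖x^{k+1} − x̄^k‖²
≤ B D². The triangle inequality finishes. -/
theorem IsRun.exists_kkt_bounds (h : T.IsRun P p) (hP : P.Admissible)
    (hbdd : Bornology.IsBounded (Set.range T.x)) (hBMP : T.BMPAtClusterPoints P) :
    ∃ c, 0 ≤ c ∧ ∀ᶠ k in atTop, ∃ v lam, P.IsKKT (T.x k) (T.xi k) (T.Q k (T.jEnd k))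
      (T.L k (T.jEnd k)) (T.xbar k (T.jEnd k)) v lam ∧ ‖lam‖ ≤ c ∧
      ‖T.xbar k (T.jEnd k) - T.x k‖ ≤ c * ‖T.x (k + 1) - T.x k‖ := by
  obtain ⟨c, hc⟩ := h.exists_multiplier_bound hP hbdd hBMP
  set e := ‖(WithLp.toLp 2 fun _ => 1 : Vec m)‖ with he
  have hμ := p.muMin_pos
  have hβR := p.betaR_pos
  have hβF := p.betaF_pos
  set B := (p.betaF + max c 0 * e * p.betaR) / p.muMin with hB
  have hB0 : 0 ≤ B := by positivity
  refine ⟨max c (Real.sqrt B + 1), le_max_of_le_right (by positivity), ?_⟩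
  filter_upwards [hc] with k ⟨v, lam, hk, hlam⟩
  refine ⟨v, lam, hk, hlam.trans (le_max_left _ _), ?_⟩
  have h1 := hk.mul_norm_sub_sq_le (h.Q_isPositive le_rfl).inner_left_eq_inner_right
    (μ := p.muMin) (fun z => le_trans (by gcongr; exact h.muMin_le k _ le_rfl)
      (h.mul_norm_sq_le_inner_Q le_rfl z)) (h.u_mem_paramSet k).1 (by positivity)
    (h.G_y_le le_rfl)
  have h2 := h.inexact_value k _ le_rfl
  rw [← h.step] at h1 h2
  have h3 : ‖T.x (k + 1) - T.xbar k (T.jEnd k)‖ ^ 2 ≤ B * ‖T.x (k + 1) - T.x k‖ ^ 2 := by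
    have h4 : ‖lam‖ * e * (p.betaR / 2 * ‖T.x (k + 1) - T.x k‖ ^ 2)
        ≤ max c 0 * e * (p.betaR / 2 * ‖T.x (k + 1) - T.x k‖ ^ 2) := by
      gcongr
      exact hlam.trans (le_max_left _ _)
    rw [hB, div_mul_eq_mul_div, le_div_iff₀ hμ]
    linarith
  have h4 : ‖T.x (k + 1) - T.xbar k (T.jEnd k)‖ ≤ Real.sqrt B * ‖T.x (k + 1) - T.x k‖ := by
    refine abs_le_of_sq_le_sq' ?_ (by positivity) |>.2
    rwa [mul_pow, Real.sq_sqrt hB0]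
  have h5 : ‖T.xbar k (T.jEnd k) - T.x k‖
      ≤ ‖T.x (k + 1) - T.xbar k (T.jEnd k)‖ + ‖T.x (k + 1) - T.x k‖ := by
    rw [norm_sub_rev (T.x (k + 1)) (T.xbar k _)]
    exact norm_sub_le_norm_sub_add_norm_sub _ _ _
  calc _ ≤ (Real.sqrt B + 1) * ‖T.x (k + 1) - T.x k‖ := by linarith
    _ ≤ _ := by gcongr; exact le_max_right _ _

end MBATrace

/-! ### The potential function and its differentiable minorants. -/

namespace ZSpace

variable {n m : ℕ}

noncomputable def xL (n m : ℕ) : ZSpace n m →L[ℝ] Vec n := WithLp.fstL 2 ℝ _ _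

noncomputable def sL (n m : ℕ) : ZSpace n m →L[ℝ] Vec n :=
  (WithLp.fstL 2 ℝ _ _).comp (WithLp.sndL 2 ℝ _ _)

noncomputable def LL (n m : ℕ) : ZSpace n m →L[ℝ] Vec m :=
  (WithLp.fstL 2 ℝ _ _).comp ((WithLp.sndL 2 ℝ _ _).comp (WithLp.sndL 2 ℝ _ _))

noncomputable def xiL (n m : ℕ) : ZSpace n m →L[ℝ] Vec n :=
  (WithLp.sndL 2 ℝ _ _).comp ((WithLp.sndL 2 ℝ _ _).comp (WithLp.sndL 2 ℝ _ _))

theorem xL_apply (z : ZSpace n m) : xL n m z = z.x := rfl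
theorem sL_apply (z : ZSpace n m) : sL n m z = z.s := rfl
theorem LL_apply (z : ZSpace n m) : LL n m z = z.L := rfl
theorem xiL_apply (z : ZSpace n m) : xiL n m z = z.xi := rfl

theorem norm_x_le (z : ZSpace n m) : ‖z.x‖ ≤ ‖z‖ := WithLp.norm_fst_le ..

theorem norm_s_le (z : ZSpace n m) : ‖z.s‖ ≤ ‖z‖ :=
  (WithLp.norm_fst_le ..).trans (WithLp.norm_snd_le ..)

theorem norm_L_le (z : ZSpace n m) : ‖z.L‖ ≤ ‖z‖ :=
  (WithLp.norm_fst_le ..).trans ((WithLp.norm_snd_le ..).trans (WithLp.norm_snd_le ..))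

theorem norm_xi_le (z : ZSpace n m) : ‖z.xi‖ ≤ ‖z‖ :=
  (WithLp.norm_snd_le ..).trans ((WithLp.norm_snd_le ..).trans (WithLp.norm_snd_le ..))

end ZSpace

namespace DCProblem

open ZSpace

variable {n m : ℕ} {P : DCProblem n m}

theorem potential_mk_eq {x s xi : Vec n} {L : Vec m} (hL : ∀ i, 0 < L i)
    (hG : P.G x s L ∈ nonposOrthant m) (hf : P.f x ≠ ⊤) (hf' : P.f x ≠ ⊥)
    (hψ : ∀ y, P.psi s - ⟪xi, y - s⟫_ℝ ≤ P.psi y) :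
    P.potential (ZSpace.mk x s L xi)
      = (((P.f x).toReal + P.phi x + ⟪x - s, xi⟫_ℝ - P.psi s : ℝ) : EReal) := by
  have h1 : conjugateFn P.psi (-xi) = ((⟪-xi, s⟫_ℝ - P.psi s : ℝ) : EReal) :=
    conjugateFn_eq_of_subgradient fun y => by
      have := hψ y
      rwa [inner_neg_left, ← sub_eq_add_neg]
  have h2 : indicatorFn (nonposOrthant m) (P.G x s L) = 0 := if_pos hG
  change (if ∀ i, 0 < L i then P.f x + ((P.phi x : ℝ) : EReal)
    + indicatorFn (nonposOrthant m) (P.G x s L) + ((⟪x, xi⟫_ℝ : ℝ) : EReal)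
    + conjugateFn P.psi (-xi) else ⊤) = _
  rw [if_pos hL, h1, h2, add_zero, ← EReal.coe_toReal hf hf', ← EReal.coe_add, ← EReal.coe_add,
    ← EReal.coe_add, EReal.coe_eq_coe_iff, EReal.toReal_coe, inner_neg_left, inner_sub_left,
    real_inner_comm xi s]
  ring

/-- A smooth local minorant of the potential, built from a multiplier `lam`, a subgradient `v` of
`φ` at `x₀` and a subgradient `-ξ` of `ψ` at `s₀`. -/
noncomputable def potentialMinorant (P : DCProblem n m) (x₀ v s₀ : Vec n) (lam : Vec m)
    (z : ZSpace n m) : ℝ :=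
  (P.f z.x).toReal + (P.phi x₀ + ⟪v, z.x - x₀⟫_ℝ) + ⟪lam, P.G z.x z.s z.L⟫_ℝ + ⟪z.x, z.xi⟫_ℝ
    + (⟪-z.xi, s₀⟫_ℝ - P.psi s₀)

/-- The comparison is termwise: the subgradient inequality for φ, ⟨λ, ·⟩ ≤ 0 on the orthant against
the indicator, and Fenchel–Young for ψ*. -/
theorem potentialMinorant_le {x₀ v : Vec n} (s₀ : Vec n) {lam : Vec m}
    (hv : ∀ y, P.phi x₀ + ⟪v, y - x₀⟫_ℝ ≤ P.phi y) (hlam : ∀ w ∈ nonposOrthant m, ⟪lam, w⟫_ℝ ≤ 0)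
    {z : ZSpace n m} (hf : P.f z.x ≠ ⊤) (hf' : P.f z.x ≠ ⊥) :
    (P.potentialMinorant x₀ v s₀ lam z : EReal) ≤ P.potential z := by
  rw [potential]
  split_ifs with hL
  · rw [potentialMinorant, EReal.coe_add, EReal.coe_add, EReal.coe_add, EReal.coe_add,
      EReal.coe_toReal hf hf']
    refine add_le_add (add_le_add (add_le_add (add_le_add le_rfl ?_) ?_) le_rfl)
      (le_conjugateFn _ _ _)
    · exact EReal.coe_le_coe_iff.2 (hv z.x)
    · rw [indicatorFn]
      split_ifs with hG
      · exact_mod_cast hlam _ hG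
      · exact le_top
  · exact le_top

/-- In the direction of s, the derivative of g(s) cancels against that of the factor x − s in
g'(s)(x − s). Only the second derivative of g survives from the linearization, paired with x − s. -/
theorem exists_hasFDerivAt_potentialMinorant (hP : P.Admissible)
    (hg : Differentiable ℝ (fderiv ℝ P.g)) {x s v s₀ xi : Vec n} {L lam : Vec m}
    (hf : HasGradientAt (fun x => (P.f x).toReal) (P.gradf x) x) :
    ∃ M' : ZSpace n m →L[ℝ] ℝ,
      HasFDerivAt (P.potentialMinorant x v s₀ lam) M' (ZSpace.mk x s L xi) ∧
      ∀ d : ZSpace n m, M' d = ⟪P.gradf x, d.x⟫_ℝ + ⟪v, d.x⟫_ℝ + ⟪lam, P.derivG x s L d.x⟫_ℝ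
        + ⟪lam, fderiv ℝ (fderiv ℝ P.g) s d.s (x - s)⟫_ℝ - ⟪x - s, d.s⟫_ℝ * ⟪lam, L⟫_ℝ
        + 1 / 2 * ‖x - s‖ ^ 2 * ⟪lam, d.L⟫_ℝ + ⟪d.x, xi⟫_ℝ + ⟪x - s₀, d.xi⟫_ℝ := by
  set z₀ : ZSpace n m := ZSpace.mk x s L xi with hz₀
  have hX : HasFDerivAt (fun z : ZSpace n m => z.x) (xL n m) z₀ := (xL n m).hasFDerivAt
  have hS : HasFDerivAt (fun z : ZSpace n m => z.s) (sL n m) z₀ := (sL n m).hasFDerivAt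
  have hΛ : HasFDerivAt (fun z : ZSpace n m => z.L) (LL n m) z₀ := (LL n m).hasFDerivAt
  have hΞ : HasFDerivAt (fun z : ZSpace n m => z.xi) (xiL n m) z₀ := (xiL n m).hasFDerivAt
  have h1 : HasFDerivAt (fun z : ZSpace n m => (P.f z.x).toReal) _ z₀ :=
    HasFDerivAt.comp z₀ (g := fun x => (P.f x).toReal) hf.hasFDerivAt hX
  have h2 := ((hasFDerivAt_const v z₀).inner ℝ (hX.sub_const x)).const_add (P.phi x)
  have hg0 : HasFDerivAt P.g (fderiv ℝ P.g s) z₀.s := (hP.g_differentiable s).hasFDerivAt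
  have hg1 : HasFDerivAt (fderiv ℝ P.g) (fderiv ℝ (fderiv ℝ P.g) s) z₀.s := (hg s).hasFDerivAt
  have hG : HasFDerivAt (fun z : ZSpace n m => P.G z.x z.s z.L) _ z₀ :=
    ((hg0.comp z₀ hS).add ((hg1.comp z₀ hS).clm_apply (hX.sub hS))).add
      (((hX.sub hS).norm_sq.const_mul (1 / 2)).smul hΛ)
  have h3 := (hasFDerivAt_const lam z₀).inner ℝ hG
  have h4 := hX.inner ℝ hΞ
  have h5 := (hΞ.neg.inner ℝ (hasFDerivAt_const s₀ z₀)).sub_const (P.psi s₀)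
  refine ⟨_, (((h1.add h2).add h3).add h4).add h5, fun d => ?_⟩
  have e1 : z₀.x = x := rfl
  have e2 : z₀.s = s := rfl
  have e3 : z₀.L = L := rfl
  have e4 : z₀.xi = xi := rfl
  have e7 : ((fun z : ZSpace n m => z.x) - fun z : ZSpace n m => z.s) z₀ = x - s := rfl
  simp only [e7, _root_.add_apply, ContinuousLinearMap.comp_apply,
    InnerProductSpace.toDual_apply_apply, fderivInnerCLM_apply, ContinuousLinearMap.prod_apply,
    _root_.zero_apply, inner_zero_left, inner_zero_right, xL_apply, sL_apply, LL_apply,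
    xiL_apply, e1, e2, e3, e4, _root_.sub_apply, _root_.smul_apply,
    ContinuousLinearMap.flip_apply, ContinuousLinearMap.smulRight_apply, innerSL_apply_apply,
    _root_.neg_apply, inner_add_right, inner_smul_right, derivG_apply, map_sub,
    inner_sub_right, inner_sub_left, inner_neg_left, smul_eq_mul, Function.comp_apply, nsmul_eq_mul]
  have e5 : ⟪d.xi, s₀⟫_ℝ = ⟪s₀, d.xi⟫_ℝ := real_inner_comm _ _
  have e6 : ⟪d.x, xi⟫_ℝ = ⟪xi, d.x⟫_ℝ := real_inner_comm _ _
  push_cast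
  linarith

/-- The distance from `0` to the subdifferential of the potential. -/
theorem infEDist_limSubdiff_potential_le (hP : P.Admissible)
    (hg : Differentiable ℝ (fderiv ℝ P.g)) {x s xi v : Vec n} {L lam : Vec m}
    {Q : Vec n →L[ℝ] Vec n} (hL : ∀ i, 0 < L i) (hG : P.G x s L ∈ nonposOrthant m)
    (hf : HasGradientAt (fun x => (P.f x).toReal) (P.gradf x) x)
    (hft : ∀ᶠ y in 𝓝 x, P.f y ≠ ⊤) (hψ : ∀ y, P.psi s - ⟪xi, y - s⟫_ℝ ≤ P.psi y)
    (hk : P.IsKKT s xi Q L x v lam) {Cf UQ Cg c UL D : ℝ}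
    (hCf : ‖P.gradf x - P.gradf s‖ ≤ Cf * ‖x - s‖) (hUQ : ‖Q‖ ≤ UQ)
    (hCg : ‖fderiv ℝ (fderiv ℝ P.g) s‖ ≤ Cg) (hc : ‖lam‖ ≤ c) (hUL : ‖L‖ ≤ UL)
    (hD : ‖x - s‖ ≤ D) :
    Metric.infEDist 0 (limSubdiff P.potential (ZSpace.mk x s L xi))
      ≤ ENNReal.ofReal ((Cf + UQ + c * Cg + c * UL + D * c + 1) * ‖x - s‖) := by
  obtain ⟨M', hM', hM'd⟩ := P.exists_hasFDerivAt_potentialMinorant hP hg (s := s) (v := v)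
    (s₀ := s) (xi := xi) (L := L) (lam := lam) hf
  set z₀ : ZSpace n m := ZSpace.mk x s L xi with hz₀
  have hval : P.potential z₀ = (P.potentialMinorant x v s lam z₀ : EReal) := by
    rw [hz₀, potential_mk_eq hL hG hft.self_of_nhds (hP.f_ne_bot x) hψ, EReal.coe_eq_coe_iff]
    change _ = (P.f x).toReal + (P.phi x + ⟪v, x - x⟫_ℝ) + ⟪lam, P.G x s L⟫_ℝ + ⟪x, xi⟫_ℝ
      + (⟪-xi, s⟫_ℝ - P.psi s)
    rw [hk.complementary, sub_self, inner_zero_right, inner_neg_left, inner_sub_left,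
      real_inner_comm xi s]
    ring
  have hle : ∀ᶠ z in 𝓝 z₀, (P.potentialMinorant x v s lam z : EReal) ≤ P.potential z := by
    have : Tendsto (fun z : ZSpace n m => z.x) (𝓝 z₀) (𝓝 x) := (xL n m).continuous.tendsto z₀
    filter_upwards [this.eventually hft] with z hz
    exact potentialMinorant_le s hk.subgradient hk.inner_nonpos hz (hP.f_ne_bot _)
  refine (infEDist_limSubdiff_le_of_minorant hval hle hM').trans (ENNReal.ofReal_le_ofReal ?_)
  have hc0 := (norm_nonneg _).trans hc
  have hCg0 := (norm_nonneg (fderiv ℝ (fderiv ℝ P.g) s)).trans hCg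
  have hUL0 := (norm_nonneg _).trans hUL
  have hUQ0 := (norm_nonneg _).trans hUQ
  have hD0 := (norm_nonneg _).trans hD
  have hCf0 : 0 ≤ Cf * ‖x - s‖ := (norm_nonneg _).trans hCf
  refine ContinuousLinearMap.opNorm_le_bound _ ?_ fun d => ?_
  · have : 0 ≤ (UQ + c * Cg + c * UL + D * c + 1) * ‖x - s‖ := by positivity
    linarith
  -- Stationarity removes φ, ξ and the constraint gradient from the x-part, leaving ∇f(x) − ∇f(s) −
  -- Q(x − s). Every remaining term is of order ‖x − s‖.
  have hd : M' d = ⟪P.gradf x - P.gradf s, d.x⟫_ℝ - ⟪Q (x - s), d.x⟫_ℝ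
      + ⟪lam, fderiv ℝ (fderiv ℝ P.g) s d.s (x - s)⟫_ℝ - ⟪x - s, d.s⟫_ℝ * ⟪lam, L⟫_ℝ
      + 1 / 2 * ‖x - s‖ ^ 2 * ⟪lam, d.L⟫_ℝ + ⟪x - s, d.xi⟫_ℝ := by
    have h1 := hk.stationary d.x
    rw [hM'd, inner_sub_left (P.gradf x)]
    rw [inner_add_left, inner_add_left, inner_add_left] at h1
    have h2 : ⟪d.x, xi⟫_ℝ = ⟪xi, d.x⟫_ℝ := real_inner_comm _ _
    linarith
  have b1 : |⟪P.gradf x - P.gradf s, d.x⟫_ℝ| ≤ Cf * ‖x - s‖ * ‖d‖ :=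
    (abs_real_inner_le_norm _ _).trans (by gcongr; exact norm_x_le d)
  have b2 : |⟪Q (x - s), d.x⟫_ℝ| ≤ UQ * ‖x - s‖ * ‖d‖ := by
    refine (abs_real_inner_le_norm _ _).trans ?_
    gcongr
    · exact (Q.le_opNorm _).trans (by gcongr)
    · exact norm_x_le d
  have b3 : |⟪lam, fderiv ℝ (fderiv ℝ P.g) s d.s (x - s)⟫_ℝ| ≤ c * (Cg * ‖d‖ * ‖x - s‖) := by
    refine (abs_real_inner_le_norm _ _).trans ?_
    gcongr
    refine (ContinuousLinearMap.le_opNorm _ _).trans ?_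
    gcongr
    refine (ContinuousLinearMap.le_opNorm _ _).trans ?_
    gcongr
    exact norm_s_le d
  have b4 : |⟪x - s, d.s⟫_ℝ * ⟪lam, L⟫_ℝ| ≤ (‖x - s‖ * ‖d‖) * (c * UL) := by
    rw [abs_mul]
    gcongr
    · exact (abs_real_inner_le_norm _ _).trans (by gcongr; exact norm_s_le d)
    · exact (abs_real_inner_le_norm _ _).trans (by gcongr)
  have b5 : |1 / 2 * ‖x - s‖ ^ 2 * ⟪lam, d.L⟫_ℝ| ≤ (D * ‖x - s‖) * (c * ‖d‖) := by
    rw [abs_mul, abs_of_nonneg (by positivity)]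
    refine mul_le_mul ?_ ?_ (abs_nonneg _) (by positivity)
    · rw [sq]
      have := mul_le_mul_of_nonneg_right hD (norm_nonneg (x - s))
      nlinarith [mul_nonneg (norm_nonneg (x - s)) (norm_nonneg (x - s))]
    · exact (abs_real_inner_le_norm _ _).trans (by gcongr; exact norm_L_le d)
  have b6 : |⟪x - s, d.xi⟫_ℝ| ≤ ‖x - s‖ * ‖d‖ :=
    (abs_real_inner_le_norm _ _).trans (by gcongr; exact norm_xi_le d)
  rw [abs_le] at b1 b2 b3 b4 b5 b6
  rw [hd, Real.norm_eq_abs, abs_le]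
  constructor <;> linarith [b1.1, b1.2, b2.1, b2.2, b3.1, b3.2, b4.1, b4.2, b5.1, b5.2, b6.1, b6.2]

end DCProblem

/-! ### The potential along the run and the KL inequality. -/

namespace MBATrace

open DCProblem ZSpace

variable {n m : ℕ} {P : DCProblem n m} {p : MBAParams} {T : MBATrace n m}

theorem IsRun.exists_tendsto_realObjective (h : T.IsRun P p) (hP : P.Admissible) :
    ∃ ϖ : ℝ, Tendsto (fun k => P.realObjective (T.x k)) atTop (𝓝 ϖ) ∧
      ∀ k, ϖ ≤ P.realObjective (T.x k) := by
  have hanti : Antitone fun k => P.realObjective (T.x k) := antitone_nat_of_succ_le fun k => by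
    have h1 := h.realObjective_decrease hP k
    have h2 := p.alpha_pos
    have h3 : 0 ≤ p.alpha / 2 * ‖T.x (k + 1) - T.x k‖ ^ 2 := by positivity
    linarith
  obtain ⟨b, hb⟩ := hP.bounded_below
  have hbdd : BddBelow (Set.range fun k => P.realObjective (T.x k)) := by
    refine ⟨b, ?_⟩
    rintro _ ⟨k, rfl⟩
    have := hb _ (h.x_mem k)
    rw [hP.F_eq (h.x_mem k)] at this
    exact_mod_cast this
  exact ⟨_, tendsto_atTop_ciInf hanti hbdd, fun k => ciInf_le hbdd k⟩

theorem IsRun.tendsto_norm_step (h : T.IsRun P p) (hP : P.Admissible) :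
    Tendsto (fun k => ‖T.x (k + 1) - T.x k‖) atTop (𝓝 0) := by
  obtain ⟨ϖ, hϖ, -⟩ := h.exists_tendsto_realObjective hP
  have h1 : Tendsto (fun k => P.realObjective (T.x k) - P.realObjective (T.x (k + 1))) atTop
      (𝓝 0) := by
    have := hϖ.sub ((tendsto_add_atTop_iff_nat 1).2 hϖ)
    rwa [sub_self] at this
  have hα := p.alpha_pos
  have h2 : Tendsto (fun k => ‖T.x (k + 1) - T.x k‖ ^ 2) atTop (𝓝 0) := by
    refine squeeze_zero (g := fun k => 2 / p.alpha *
      (P.realObjective (T.x k) - P.realObjective (T.x (k + 1)))) (fun k => sq_nonneg _)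
      (fun k => ?_) (by simpa using h1.const_mul (2 / p.alpha))
    have := h.realObjective_decrease hP k
    rw [div_mul_eq_mul_div, le_div_iff₀ hα]
    linarith
  have h3 := h2.sqrt
  simpa [Real.sqrt_sq (norm_nonneg _)] using h3

/-- The value of the potential at `zᵏ`. -/
noncomputable def potentialValue (T : MBATrace n m) (P : DCProblem n m) (k : ℕ) : ℝ :=
  (P.f (T.xbar k (T.jEnd k))).toReal + P.phi (T.xbar k (T.jEnd k))
    + ⟪T.xbar k (T.jEnd k) - T.x k, T.xi k⟫_ℝ - P.psi (T.x k)

theorem IsRun.potential_z_eq (h : T.IsRun P p) (hP : P.Admissible) {k : ℕ}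
    (hf : P.f (T.xbar k (T.jEnd k)) ≠ ⊤) :
    P.potential (T.z k) = (T.potentialValue P k : EReal) :=
  potential_mk_eq (fun i => p.LMin_pos.trans_le (h.LMin_le k _ le_rfl i)) (h.xbar_mem k _ le_rfl)
    hf (hP.f_ne_bot _) (h.psi_le hP k)

/-- The potential at `zᵏ` against the objective at `xᵏ` and `xᵏ⁺¹`, and the distance of `0` to its
subdifferential. -/
theorem IsRun.exists_potential_bounds (h : T.IsRun P p) (hP : P.Admissible)
    (hbdd : Bornology.IsBounded (Set.range T.x)) (hBMP : T.BMPAtClusterPoints P)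
    (hg : Differentiable ℝ (fderiv ℝ P.g)) :
    ∃ C, 0 ≤ C ∧ ∀ᶠ k in atTop,
      P.potential (T.z k) = (T.potentialValue P k : EReal) ∧
      ‖T.xbar k (T.jEnd k) - T.x k‖ ≤ C * ‖T.x (k + 1) - T.x k‖ ∧
      P.realObjective (T.x (k + 1)) ≤ T.potentialValue P k + C * ‖T.x (k + 1) - T.x k‖ ^ 2 ∧
      T.potentialValue P k ≤ P.realObjective (T.x k) + C * ‖T.x (k + 1) - T.x k‖ ^ 2 ∧
      Metric.infEDist 0 (limSubdiff P.potential (T.z k))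
        ≤ ENNReal.ofReal (C * ‖T.x (k + 1) - T.x k‖) := by
  obtain ⟨R, hR0, hR⟩ := h.exists_norm_iterates_le hP hbdd
  obtain ⟨ε, hε, Cf, hCf0, hCf⟩ := hP.exists_f_bounds R
  obtain ⟨Cg, hCg0, hCg⟩ := hP.exists_g_bounds R
  obtain ⟨UL, hUL0, hUL⟩ := h.exists_norm_L_le hP hbdd
  obtain ⟨UQ, hUQ0, hUQ⟩ := h.exists_norm_Q_le hP hbdd
  obtain ⟨c, hc0, hc⟩ := h.exists_kkt_bounds hP hbdd hBMP
  have hβF := p.betaF_pos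
  set B := Cf + UQ + c * Cg + c * UL + (R + R) * c + 1 with hB
  have hB0 : 0 ≤ B := by positivity
  -- Contributions in order: the Taylor error of f at x^{k+1}, the inexactness of its model value,
  -- and the Taylor error of f and the Q-term at x̄^k, where ‖x̄^k − x^k‖ ≤ c D.
  set C₁ := Cf + p.betaF / 2 + (Cf + UQ) * c ^ 2 with hC₁
  have hC₁0 : 0 ≤ C₁ := by positivity
  -- Since the steps vanish, x̄^k eventually enters the ε-ball around x^k on which f is finite and
  -- smooth.
  have hnear : ∀ᶠ k in atTop, c * ‖T.x (k + 1) - T.x k‖ ≤ ε := by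
    have := (h.tendsto_norm_step hP).const_mul c
    rw [mul_zero] at this
    exact this.eventually (ge_mem_nhds hε)
  refine ⟨c + C₁ + B * c, by positivity, ?_⟩
  filter_upwards [hc, hnear] with k ⟨v, lam, hk, hlam, hdist⟩ hkε
  set D := ‖T.x (k + 1) - T.x k‖ with hD
  have hD0 : 0 ≤ D := norm_nonneg _
  set xb := T.xbar k (T.jEnd k) with hxb
  obtain ⟨hgrad, hft, hfq, hfl⟩ := (hCf (T.x k) (h.x_mem k) (hR k).1).2 xb
    (Or.inl (by rw [dist_eq_norm]; exact hdist.trans hkε))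
  have hfy := ((hCf (T.x k) (h.x_mem k) (hR k).1).2 (T.x (k + 1))
    (Or.inr ⟨h.x_mem _, (hR _).1⟩)).2.2.1
  have hsq : ‖xb - T.x k‖ ^ 2 ≤ c ^ 2 * D ^ 2 := by
    rw [← mul_pow]; exact pow_le_pow_left₀ (norm_nonneg _) hdist 2
  have hsub := P.subObjective_sub (T.x k) (T.xi k) (T.Q k (T.jEnd k)) xb (T.x k)
  rw [subObjective_self] at hsub
  simp only [sub_self, map_zero, inner_zero_right, mul_zero, inner_add_left] at hsub
  have hQ0 : 0 ≤ ⟪xb - T.x k, T.Q k (T.jEnd k) (xb - T.x k)⟫_ℝ :=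
    (h.Q_isPositive le_rfl).inner_nonneg_right _
  have hQ1 : ⟪xb - T.x k, T.Q k (T.jEnd k) (xb - T.x k)⟫_ℝ ≤ UQ * ‖xb - T.x k‖ ^ 2 := by
    refine (real_inner_le_norm _ _).trans ?_
    have := ((T.Q k (T.jEnd k)).le_opNorm (xb - T.x k)).trans
      (mul_le_mul_of_nonneg_right (hUQ k) (norm_nonneg _))
    calc _ ≤ ‖xb - T.x k‖ * (UQ * ‖xb - T.x k‖) := by gcongr
      _ = _ := by ring
  have hcomm : ⟪xb - T.x k, T.xi k⟫_ℝ = ⟪T.xi k, xb - T.x k⟫_ℝ := real_inner_comm _ _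
  rw [abs_le] at hfq
  have hval : T.potentialValue P k = (P.f xb).toReal + P.phi xb + ⟪xb - T.x k, T.xi k⟫_ℝ
    - P.psi (T.x k) := rfl
  have hobj : P.realObjective (T.x k)
    = (P.f (T.x k)).toReal + (P.phi (T.x k) - P.psi (T.x k)) := rfl
  have hmul : ∀ a, 0 ≤ a → a * ‖xb - T.x k‖ ^ 2 ≤ a * c ^ 2 * D ^ 2 := fun a ha => by
    have := mul_le_mul_of_nonneg_left hsq ha
    linarith
  have hC₁le : C₁ * D ^ 2 ≤ (c + C₁ + B * c) * D ^ 2 := by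
    gcongr
    have : 0 ≤ B * c := by positivity
    linarith
  refine ⟨h.potential_z_eq hP hft.self_of_nhds, hdist.trans ?_, ?_, ?_, ?_⟩
  · gcongr
    have : 0 ≤ B * c := by positivity
    linarith
  · refine le_trans ?_ (add_le_add_right hC₁le _)
    have h1 := realObjective_le_subObjective (Q := T.Q k (T.jEnd k)) hfy (h.psi_le hP k _)
    have h2 := h.inexact_value k _ le_rfl
    rw [← h.step] at h2
    have h3 : 0 ≤ ⟪T.x (k + 1) - T.x k, T.Q k (T.jEnd k) (T.x (k + 1) - T.x k)⟫_ℝ :=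
      (h.Q_isPositive le_rfl).inner_nonneg_right _
    have h4 := hmul Cf hCf0
    have h5 := hmul UQ hUQ0
    rw [hC₁, hval, hcomm]
    have h6 : 0 ≤ UQ * c ^ 2 * D ^ 2 := by positivity
    linarith [hfq.1]
  · refine le_trans ?_ (add_le_add_right hC₁le _)
    have h1 : P.subObjective (T.x k) (T.xi k) (T.Q k (T.jEnd k)) xb
        ≤ P.subObjective (T.x k) (T.xi k) (T.Q k (T.jEnd k)) (T.x k) :=
      h.xbar_min k _ le_rfl (by
        change P.G (T.x k) (T.x k) (T.L k (T.jEnd k)) ∈ nonposOrthant m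
        rw [G_self]
        exact h.x_mem k)
    rw [subObjective_self] at h1
    have h4 := hmul Cf hCf0
    have h5 : 0 ≤ UQ * c ^ 2 * D ^ 2 := by positivity
    have h6 : 0 ≤ p.betaF / 2 * D ^ 2 := by positivity
    have h7 : 0 ≤ Cf * D ^ 2 := by positivity
    rw [hC₁, hval, hcomm]
    linarith [hfq.2]
  · refine (infEDist_limSubdiff_potential_le hP hg
      (fun i => p.LMin_pos.trans_le (h.LMin_le k _ le_rfl i)) (h.xbar_mem k _ le_rfl) hgrad hft
      (h.psi_le hP k) hk hfl (hUQ k) (hCg _ (hR k).1).1 hlam (hUL k)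
      (norm_sub_le_of_le ((hR k).2 _ le_rfl).2 (hR k).1)).trans (ENNReal.ofReal_le_ofReal ?_)
    calc B * ‖xb - T.x k‖ ≤ B * (c * D) := by gcongr
      _ ≤ (c + C₁ + B * c) * D := by
        have : 0 ≤ (c + C₁) * D := by positivity
        linarith

theorem IsRun.isBounded_range_z (h : T.IsRun P p) (hP : P.Admissible)
    (hbdd : Bornology.IsBounded (Set.range T.x)) : Bornology.IsBounded (Set.range T.z) := by
  obtain ⟨R, hR0, hR⟩ := h.exists_norm_iterates_le hP hbdd
  obtain ⟨UL, hUL0, hUL⟩ := h.exists_norm_L_le hP hbdd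
  obtain ⟨Kξ, hKξ0, hKξ⟩ := h.exists_norm_xi_le hP hbdd
  have key : ∀ {α β : Type} [NormedAddCommGroup α] [NormedAddCommGroup β] (a : α) (b : β),
      ‖(WithLp.toLp 2 (a, b) : WithLp 2 (α × β))‖ ≤ ‖a‖ + ‖b‖ := by
    intro α β _ _ a b
    rw [WithLp.prod_norm_eq_of_L2]
    refine Real.sqrt_le_iff.2 ⟨by positivity, ?_⟩
    change ‖a‖ ^ 2 + ‖b‖ ^ 2 ≤ _
    nlinarith [norm_nonneg a, norm_nonneg b]
  rw [isBounded_iff_forall_norm_le]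
  refine ⟨R + (R + (UL + Kξ)), ?_⟩
  rintro _ ⟨k, rfl⟩
  refine (key _ _).trans (add_le_add ((hR k).2 _ le_rfl).2 ?_)
  refine (key _ _).trans (add_le_add (hR k).1 ?_)
  exact (key _ _).trans (add_le_add (hUL k) (hKξ k))

/-- The potential is constant on the set of cluster points of `zᵏ`. -/
theorem IsRun.potential_eq_of_mapClusterPt (h : T.IsRun P p) (hP : P.Admissible)
    (hbdd : Bornology.IsBounded (Set.range T.x)) (hBMP : T.BMPAtClusterPoints P) {ϖ : ℝ}
    (hϖ : Tendsto (fun k => P.realObjective (T.x k)) atTop (𝓝 ϖ)) {z : ZSpace n m}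
    (hz : MapClusterPt z atTop T.z) : P.potential z = ϖ := by
  obtain ⟨c, hc0, hc⟩ := h.exists_kkt_bounds hP hbdd hBMP
  obtain ⟨θ, hθ, hlim⟩ := hz.tendsto_subseq
  have hx : Tendsto (fun k => T.xbar (θ k) (T.jEnd (θ k))) atTop (𝓝 z.x) :=
    ((xL n m).continuous.tendsto z).comp hlim
  have hs : Tendsto (fun k => T.x (θ k)) atTop (𝓝 z.s) :=
    ((sL n m).continuous.tendsto z).comp hlim
  have hL : Tendsto (fun k => T.L (θ k) (T.jEnd (θ k))) atTop (𝓝 z.L) :=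
    ((LL n m).continuous.tendsto z).comp hlim
  have hξ : Tendsto (fun k => T.xi (θ k)) atTop (𝓝 z.xi) :=
    ((xiL n m).continuous.tendsto z).comp hlim
  have hdiff : Tendsto (fun k => T.xbar k (T.jEnd k) - T.x k) atTop (𝓝 0) := by
    refine squeeze_zero_norm' (a := fun k => c * ‖T.x (k + 1) - T.x k‖) ?_ ?_
    · filter_upwards [hc] with k ⟨_, _, _, _, hk⟩ using hk
    · simpa using (h.tendsto_norm_step hP).const_mul c
  have hxs : z.x = z.s := by
    rw [← sub_eq_zero]
    exact tendsto_nhds_unique (hx.sub hs) (hdiff.comp hθ.tendsto_atTop)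
  have hfeas : z.s ∈ P.feasible :=
    hP.isClosed_feasible.mem_of_tendsto hs (Eventually.of_forall fun k => h.x_mem _)
  have hLpos : ∀ i, 0 < z.L i := fun i => by
    have h1 : Tendsto (fun k => T.L (θ k) (T.jEnd (θ k)) i) atTop (𝓝 (z.L i)) :=
      ((EuclideanSpace.proj (𝕜 := ℝ) i).continuous.tendsto z.L).comp hL
    exact p.LMin_pos.trans_le (ge_of_tendsto h1
      (Eventually.of_forall fun k => h.LMin_le _ _ le_rfl i))
  have hψc := hP.psi_convex.locallyLipschitz.continuous
  have hφc := hP.phi_convex.locallyLipschitz.continuous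
  -- The supergradient inequality survives the limit, so Fenchel–Young equality gives ψ* at the
  -- cluster point itself.
  have hψ : ∀ y, P.psi z.s - ⟪z.xi, y - z.s⟫_ℝ ≤ P.psi y := fun y =>
    le_of_tendsto (((hψc.tendsto _).comp hs).sub (hξ.inner (tendsto_const_nhds.sub hs)))
      (Eventually.of_forall fun k => h.psi_le hP _ y)
  have hG : P.G z.x z.s z.L ∈ nonposOrthant m := by
    rw [hxs, G_self]; exact hfeas
  have hft : P.f z.x ≠ ⊤ := by rw [hxs]; exact hP.f_ne_top hfeas
  have hpot : P.potential z
      = (((P.f z.x).toReal + P.phi z.x + ⟪z.x - z.s, z.xi⟫_ℝ - P.psi z.s : ℝ) : EReal) :=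
    potential_mk_eq hLpos hG hft (hP.f_ne_bot _) hψ
  rw [hpot, hxs, sub_self, inner_zero_left, add_zero, EReal.coe_eq_coe_iff]
  have hcont : ContinuousAt P.realObjective z.s := by
    obtain ⟨ε, hε, C, -, hC⟩ := hP.exists_f_bounds ‖z.s‖
    have h1 := ((hC z.s hfeas le_rfl).2 z.s (Or.inr ⟨hfeas, le_rfl⟩)).1.differentiableAt
    exact h1.continuousAt.add (hφc.continuousAt.sub hψc.continuousAt)
  have h1 := tendsto_nhds_unique (hcont.tendsto.comp hs) (hϖ.comp hθ.tendsto_atTop)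
  rw [← h1, realObjective]
  ring

/-- Φ(z^k) → ϖ, the common value of Φ at all cluster points, so z^k eventually lies in the value
range of each local KL inequality. Combining that inequality with the O(D) subgradient bound gives
the constant c (1 − q) C near each cluster point. -/
theorem IsRun.exists_kl_inequality (h : T.IsRun P p) (hP : P.Admissible)
    (hbdd : Bornology.IsBounded (Set.range T.x)) (hBMP : T.BMPAtClusterPoints P)
    (hg : Differentiable ℝ (fderiv ℝ P.g)) {q : ℝ} (hq : q ∈ Set.Ico (1 / 2 : ℝ) 1)
    (hKL : ∀ z : ZSpace n m, MapClusterPt z atTop T.z → HasKLExponentAt P.potential q z)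
    {ϖ : ℝ} (hϖ : Tendsto (fun k => P.realObjective (T.x k)) atTop (𝓝 ϖ)) :
    ∃ c, ∀ᶠ k in atTop, ϖ < T.potentialValue P k →
      (T.potentialValue P k - ϖ) ^ q ≤ c * ‖T.x (k + 1) - T.x k‖ := by
  obtain ⟨C, hC0, hC⟩ := h.exists_potential_bounds hP hbdd hBMP hg
  have hstep := h.tendsto_norm_step hP
  have hlim : Tendsto (T.potentialValue P) atTop (𝓝 ϖ) := by
    have h1 : Tendsto (fun k => C * ‖T.x (k + 1) - T.x k‖ ^ 2) atTop (𝓝 0) := by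
      simpa using (hstep.pow 2).const_mul C
    refine tendsto_of_tendsto_of_tendsto_of_le_of_le'
      (g := fun k => P.realObjective (T.x (k + 1)) - C * ‖T.x (k + 1) - T.x k‖ ^ 2)
      (h := fun k => P.realObjective (T.x k) + C * ‖T.x (k + 1) - T.x k‖ ^ 2) ?_ ?_ ?_ ?_
    · simpa using ((tendsto_add_atTop_iff_nat 1).2 hϖ).sub h1
    · simpa using hϖ.add h1
    · filter_upwards [hC] with k hk
      linarith [hk.2.2.1]
    · filter_upwards [hC] with k hk using hk.2.2.2.1
  refine exists_eventually_of_mapClusterPt (h.isBounded_range_z hP hbdd) ?_ ?_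
  · intro c c' k hcc' hk h1
    exact (hk h1).trans (by gcongr)
  intro z hz
  have hpz := h.potential_eq_of_mapClusterPt hP hbdd hBMP hϖ hz
  obtain ⟨-, δ, hδ, η, hη, c, hc, hkl⟩ := hKL z hz
  have hη' : ∀ᶠ k in atTop, (T.potentialValue P k : EReal) < ϖ + η := by
    have h1 : Tendsto (fun k => (T.potentialValue P k : EReal)) atTop (𝓝 (ϖ : EReal)) :=
      (continuous_coe_real_ereal.tendsto ϖ).comp hlim
    refine h1.eventually (gt_mem_nhds ?_)
    induction η with
    | bot => simp at hη
    | top => rw [EReal.coe_add_top]; exact EReal.coe_lt_top ϖ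
    | coe η =>
      have : 0 < η := by exact_mod_cast hη
      exact_mod_cast (by linarith : ϖ < ϖ + η)
  refine ⟨c * (1 - q) * C, Metric.closedBall z δ, Metric.closedBall_mem_nhds z hδ, ?_⟩
  filter_upwards [hC, hη'] with k hk hkη hkz hlt
  have h1 := hkl (T.z k) hkz (by rw [hpz, hk.1]; exact_mod_cast hlt) (by rwa [hpz, hk.1])
  rw [hpz, hk.1, ← EReal.coe_sub, EReal.toReal_coe] at h1
  set t := T.potentialValue P k - ϖ with ht
  have ht0 : 0 < t := sub_pos.2 hlt
  have hq1 : 0 < 1 - q := by linarith [hq.2]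
  have h2 := h1.trans (mul_le_mul_right hk.2.2.2.2 _)
  rw [← ENNReal.ofReal_mul (by positivity), ENNReal.one_le_ofReal, Real.rpow_neg ht0.le] at h2
  have htq : 0 < t ^ q := Real.rpow_pos_of_pos ht0 q
  have h3 := mul_le_mul_of_nonneg_right h2 htq.le
  rw [one_mul] at h3
  refine h3.trans_eq ?_
  field_simp

/-- Transfer from Φ(z^k) to F(x^{k+1}) by subadditivity of t ↦ t^q, with D^(2q) ≤ D for D ≤ 1 and 2q
≥ 1. The positive part t covers the case Φ(z^k) ≤ ϖ, where the KL inequality gives no information.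
-/
theorem IsRun.exists_rpow_le (h : T.IsRun P p) (hP : P.Admissible)
    (hbdd : Bornology.IsBounded (Set.range T.x)) (hBMP : T.BMPAtClusterPoints P)
    (hg : Differentiable ℝ (fderiv ℝ P.g)) {q : ℝ} (hq : q ∈ Set.Ico (1 / 2 : ℝ) 1)
    (hKL : ∀ z : ZSpace n m, MapClusterPt z atTop T.z → HasKLExponentAt P.potential q z)
    {ϖ : ℝ} (hϖ : Tendsto (fun k => P.realObjective (T.x k)) atTop (𝓝 ϖ))
    (hle : ∀ k, ϖ ≤ P.realObjective (T.x k)) :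
    ∃ c, 0 < c ∧ ∀ᶠ k in atTop,
      (P.realObjective (T.x (k + 1)) - ϖ) ^ q ≤ c * ‖T.x (k + 1) - T.x k‖ := by
  obtain ⟨C, hC0, hC⟩ := h.exists_potential_bounds hP hbdd hBMP hg
  obtain ⟨c, hc⟩ := h.exists_kl_inequality hP hbdd hBMP hg hq hKL hϖ
  have hq0 : 0 < q := by linarith [hq.1]
  refine ⟨max c 0 + C ^ q + 1, by positivity, ?_⟩
  filter_upwards [hC, hc, (h.tendsto_norm_step hP).eventually (ge_mem_nhds zero_lt_one)]
    with k hk hkc hD1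
  set D := ‖T.x (k + 1) - T.x k‖ with hD
  have hD0 : 0 ≤ D := norm_nonneg _
  set t := max (T.potentialValue P k - ϖ) 0 with ht
  have htq : t ^ q ≤ max c 0 * D := by
    rcases lt_or_ge ϖ (T.potentialValue P k) with hlt | hge
    · rw [ht, max_eq_left (by linarith)]
      exact (hkc hlt).trans (by gcongr; exact le_max_left _ _)
    · rw [ht, max_eq_right (by linarith), Real.zero_rpow hq0.ne']
      positivity
  have h1 : P.realObjective (T.x (k + 1)) - ϖ ≤ t + C * D ^ 2 := by
    have := le_max_left (T.potentialValue P k - ϖ) 0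
    linarith [hk.2.2.1]
  have h2 : (C * D ^ 2) ^ q ≤ C ^ q * D := by
    rw [Real.mul_rpow hC0 (by positivity), ← Real.rpow_natCast_mul hD0]
    gcongr
    rcases hD0.eq_or_lt with h0 | h0
    · rw [← h0, Real.zero_rpow (by positivity)]
    · refine (Real.rpow_le_rpow_of_exponent_ge h0 hD1 ?_).trans_eq (Real.rpow_one D)
      push_cast
      linarith [hq.1]
  calc _ ≤ (t + C * D ^ 2) ^ q := Real.rpow_le_rpow (sub_nonneg.2 (hle _)) h1 hq0.le
    _ ≤ t ^ q + (C * D ^ 2) ^ q :=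
      Real.rpow_add_le_add_rpow (le_max_right _ _) (by positivity) hq0.le hq.2.le
    _ ≤ (max c 0 + C ^ q + 1) * D := by linarith

end MBATrace

theorem theorem4p6 {n m : ℕ} (P : DCProblem n m) (hP : P.Admissible)
    (p : MBAParams) (T : MBATrace n m) (hrun : T.IsRun P p)
    (hsub : T.SubproblemsSubregular P)
    (hbdd : Bornology.IsBounded (Set.range T.x))
    (hBMP : T.BMPAtClusterPoints P)
    (hg : Differentiable ℝ (fderiv ℝ P.g))
    (hpsi : ContinuousOn (conjugateFn P.psi) {y | conjugateFn P.psi y < ⊤})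
    (q : ℝ) (hq : q ∈ Set.Ico (1 / 2 : ℝ) 1)
    (hKL : ∀ z : ZSpace n m, MapClusterPt z atTop T.z → HasKLExponentAt P.potential q z) :
    ∃ (varpi : ℝ) (xstar : Vec n),
      Tendsto (fun k => P.F (T.x k)) atTop (𝓝 (varpi : EReal)) ∧
      Tendsto T.x atTop (𝓝 xstar) ∧
      (q = 1 / 2 →
        ∃ a₁ : ℝ, 0 < a₁ ∧ ∃ ρ ∈ Set.Ioo (0 : ℝ) 1, ∃ ρ' ∈ Set.Ioo (0 : ℝ) 1,
          ∀ᶠ k : ℕ in atTop,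
            P.F (T.x (k + 1)) - (varpi : EReal) ≤ (ρ : EReal) * (P.F (T.x k) - (varpi : EReal)) ∧
            ‖T.x k - xstar‖ ≤ a₁ * ρ' ^ k) ∧
      (1 / 2 < q →
        ∃ a₂ : ℝ, 0 < a₂ ∧ ∃ a₃ : ℝ, 0 < a₃ ∧
          ∀ᶠ k : ℕ in atTop,
            P.F (T.x k) - (varpi : EReal) ≤ ((a₂ * (k : ℝ) ^ (1 / (1 - 2 * q)) : ℝ) : EReal) ∧
            ‖T.x k - xstar‖ ≤ a₃ * (k : ℝ) ^ ((1 - q) / (1 - 2 * q))) := by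
  have hcoe : ∀ k, P.F (T.x k) = (P.realObjective (T.x k) : EReal) := fun k => hP.F_eq (hrun.x_mem k)
  obtain ⟨ϖ, hϖ, hle⟩ := hrun.exists_tendsto_realObjective hP
  obtain ⟨c, hc, hkl⟩ := hrun.exists_rpow_le hP hbdd hBMP hg hq hKL hϖ hle
  have hα := p.alpha_pos
  obtain ⟨xstar, hx, h1, h2⟩ := convergence_rates_of_kl (x := T.x)
    (r := fun k => P.realObjective (T.x k) - ϖ) hq (fun k => sub_nonneg.2 (hle k))
    (by simpa using hϖ.sub_const ϖ) (half_pos hα) hc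
    (fun k => by have := hrun.realObjective_decrease hP k; linarith) hkl
  refine ⟨ϖ, xstar, ?_, hx, fun hq => ?_, fun hq => ?_⟩
  · simp only [hcoe]
    exact (continuous_coe_real_ereal.tendsto ϖ).comp hϖ
  · obtain ⟨a₁, ha₁, ρ, hρ, ρ', hρ', h⟩ := h1 hq
    refine ⟨a₁, ha₁, ρ, hρ, ρ', hρ', h.mono fun k hk => ⟨?_, hk.2⟩⟩
    rw [hcoe, hcoe]
    exact_mod_cast hk.1
  · obtain ⟨a₂, ha₂, a₃, ha₃, h⟩ := h2 hq
    refine ⟨a₂, ha₂, a₃, ha₃, h.mono fun k hk => ⟨?_, hk.2⟩⟩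
    rw [hcoe]
    exact_mod_cast hk.1
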